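/- Write $L^2(\mathbb R)$ for the real Hilbert space of square-integrable functions $\mathbb R\to\mathbb R$, and for $\phi\in L^2(\mathbb R)$ and $j,m\in\mathbb Z$ put $\phi_{j,m}(x)=2^{j/2}\phi(2^jx-m)$. A multi-resolution analysis (MRA) with scaling function $\phi\in L^2(\mathbb R)$ is an increasing sequence of closed subspaces $(V_j)_{j\in\mathbb Z}$ of $L^2(\mathbb R)$ such that $\bigcup_jV_j$ is dense, $\bigcap_jV_j=\{0\}$, $f\in V_j$ if and only if $f(2^{-j}\,\cdot)\in V_0$, and $(\phi_{0,m})_{m\in\mathbb Z}$ is an orthonormal basis of $V_0$. Let $P_V$ denote the orthogonal projection onto a closed subspace $V$, acting componentwise on tuples. **The network.** Let $S\ge 0$, $L\ge 1$ and $j_1\in\mathbb Z$, and for $l=1,\dots,L$ let $j_l=j_1+l-1$ and $c_l=2^{L-l}$. Let $(V_j)$ be an MRA with scaling function $\phi$. Let $F:\mathbb R^S\to(V_{j_1})^{c_1}$ be linear, $b\in(V_{j_1})^{c_1}$ and $\sigma:\mathbb R\to\mathbb R$. For $l=2,\dots,L$, $1\le i\le c_{l-1}$ and $1\le k\le c_l$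 let $t^l_{i,k}\in V_{j_l}\cap L^1(\mathbb R)$ be filters and $b^l_k\in V_{j_l}$ biases. Put $$\Psi_1(z)=Fz+b,\qquad \tilde\Psi_l(f)=\Big(P_{V_{j_l}}\Big(\sum_{i=1}^{c_{l-1}}f_i*t^l_{i,k}+b^l_k\Big)\Big)_{k=1}^{c_l},\qquad \tilde\sigma_l(f)=\big(P_{V_{j_l}}(\sigma\circ f_k)\big)_{k=1}^{c_l},$$ and define the generator $$G=\tilde\sigma_L\circ\tilde\Psi_L\circ\cdots\circ\tilde\sigma_2\circ\tilde\Psi_2\circ\tilde\sigma_1\circ\Psi_1:\ \mathbb R^S\to V_{j_L}\subset L^2(\mathbb R).$$ **Hypotheses.** Assume: 1. $\phi$ is bounded and compactly supported, and there is $r\in\mathbb Z$ such that $\int_{\mathbb R^2}\phi(t)\phi(z)\phi(z-2t+r)\,dz\,dt\ne0$. 2. There are $\bar p\in\mathbb N$ and real numbers $d^l_{p,i,k}$ (with $d^l_{p,i,k}=0$ for $p>\bar p$) such that $t^l_{i,k}=\sum_{p=0}^{\bar p}d^l_{p,i,k}\,\phi_{j_l,p}$ for all $l=2,\dots,L$,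 $1\le i\le c_{l-1}$, $1\le k\le c_l$; moreover $\det D^l\neq0$ for every $l=2,\dots,L$, where $D^l$ is the $c_{l-1}\times c_{l-1}$ matrix with $(D^l)_{i,k}=d^l_{0,i,k}$ for $1\le k\le c_l$ and $(D^l)_{i,k}=d^l_{1,i,k-c_l}$ for $c_l<k\le 2c_l=c_{l-1}$. 3. $\sigma\in C^1(\mathbb R)$ is injective, $M_1\le\sigma'\le M_2$ on $\mathbb R$ for some $M_1,M_2>0$, $\sigma(0)=0$, and $x\,\sigma(x)\ge0$ for every $x\in\mathbb R$. 4. $F$ is injective, and there is $N\in\mathbb N$ such that $b$ and the range of $F$ lie in $(\operatorname{span}\{\phi_{j_1,m}\}_{m=-N}^{N})^{c_1}$. Let $\mathcal M=G(\mathbb R^S)$, with tangent space $T_x\mathcal M$ at $x=G(z)$ equal to the range of $G'(z)$, and let $K\subset\mathcal M$ be compact. Let $Y$ be a Banach space and let $\mathcal F:L^2(\mathbb R)\to Y$ be an injective map of class $C^1$ such that $\mathcal F'(x)|_{T_x\mathcal M}$ is injective for every $x\in\mathcal M$. **Conclusion.** There is a constant $C>0$ such that $$\|x-y\|_{L^2(\mathbb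 R)}\le C\,\|\mathcal F(x)-\mathcal F(y)\|_Y\qquad\text{for all }x,y\in K.$$ -/

import Mathlib

open MeasureTheory
open scoped ENNReal

noncomputable section

namespace ContGen

/-- The real Hilbert space `L²(ℝ)`. -/
abbrev L2R : Type := Lp ℝ 2 (volume : Measure ℝ)

/-! ### Well-definedness of dilations, convolutions and pointwise nonlinearities on `L²(ℝ)` -/

theorem memLp_affine {f : ℝ → ℝ} (hf : MemLp f 2 volume) {a : ℝ}
    (ha : a ≠ 0) (b c : ℝ) : MemLp (fun x => c * f (a * x - b)) 2 volume := by
  refine MemLp.const_mul ?_ c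
  have h1 : MemLp (fun x => f (x - b)) 2 volume :=
    hf.comp_measurePreserving (measurePreserving_sub_right volume b)
  have h2 := h1.smul_measure (c := ENNReal.ofReal |a⁻¹|) ENNReal.ofReal_ne_top
  rw [← Real.map_volume_mul_left ha] at h2
  exact h2.comp_of_map (measurable_const_mul a).aemeasurable

theorem memLp_conv {f g : ℝ → ℝ} (hf : MemLp f 2 volume)
    (hg : Integrable g volume) :
    MemLp (convolution f g (ContinuousLinearMap.lsmul ℝ ℝ) volume) 2 volume := by
  have hm : AEStronglyMeasurable (fun p : ℝ × ℝ => f p.2 * g (p.1 - p.2))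
      (volume.prod volume) :=
    hf.1.convolution_integrand (ContinuousLinearMap.lsmul ℝ ℝ) hg.1
  have hc : AEStronglyMeasurable (convolution f g (ContinuousLinearMap.lsmul ℝ ℝ) volume)
      volume := hm.integral_prod_right'
  refine ⟨hc, ?_⟩
  rw [eLpNorm_lt_top_iff_lintegral_rpow_enorm_lt_top (by norm_num) (by norm_num)]
  have hgx : ∀ x : ℝ, AEMeasurable (fun t => ‖g (x - t)‖ₑ) volume := fun x =>
    (hg.1.comp_quasiMeasurePreserving
      (Measure.measurePreserving_sub_left volume x).quasiMeasurePreserving).enorm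
  have hG : ∀ x : ℝ, ∫⁻ t, ‖g (x - t)‖ₑ = ∫⁻ t, ‖g t‖ₑ := fun x =>
    lintegral_sub_left_eq_self (fun t => ‖g t‖ₑ) x
  have hb : ∀ x, ‖convolution f g (ContinuousLinearMap.lsmul ℝ ℝ) volume x‖ₑ ^ (2 : ℝ)
      ≤ (∫⁻ t, ‖f t‖ₑ ^ (2 : ℝ) * ‖g (x - t)‖ₑ) * ∫⁻ t, ‖g t‖ₑ := by
    intro x
    have h1 : ‖convolution f g (ContinuousLinearMap.lsmul ℝ ℝ) volume x‖ₑ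
        ≤ ∫⁻ t, ((fun t => ‖f t‖ₑ * ‖g (x - t)‖ₑ ^ (1 / 2 : ℝ)) *
            fun t => ‖g (x - t)‖ₑ ^ (1 / 2 : ℝ)) t := by
      refine (enorm_integral_le_lintegral_enorm _).trans (le_of_eq ?_)
      refine lintegral_congr fun t => ?_
      simp only [ContinuousLinearMap.lsmul_apply, smul_eq_mul, enorm_mul, Pi.mul_apply]
      rw [mul_assoc, ← ENNReal.rpow_add_of_nonneg _ _ (by norm_num) (by norm_num)]
      norm_num
    have h2 := h1.trans (ENNReal.lintegral_mul_le_Lp_mul_Lq volume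
      Real.HolderConjugate.two_two (hf.1.enorm.mul ((hgx x).pow_const _))
      ((hgx x).pow_const _))
    refine (ENNReal.rpow_le_rpow h2 (by norm_num : (0 : ℝ) ≤ 2)).trans (le_of_eq ?_)
    rw [ENNReal.mul_rpow_of_nonneg _ _ (by norm_num), ← ENNReal.rpow_mul, ← ENNReal.rpow_mul]
    norm_num
    rw [← hG x]
    congr 1
    · refine lintegral_congr fun t => ?_
      rw [mul_pow, ← ENNReal.rpow_natCast, ← ENNReal.rpow_natCast, ← ENNReal.rpow_mul]
      norm_num
    · refine lintegral_congr fun t => ?_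
      rw [← ENNReal.rpow_natCast, ← ENNReal.rpow_mul]
      norm_num
  have hgf : ∫⁻ t, ‖g t‖ₑ < ∞ := hg.2
  have hff : ∫⁻ t, ‖f t‖ₑ ^ (2 : ℝ) < ∞ := by
    have := hf.2
    rwa [eLpNorm_lt_top_iff_lintegral_rpow_enorm_lt_top (by norm_num) (by norm_num)] at this
  have hm2 : AEMeasurable (fun p : ℝ × ℝ => ‖f p.2‖ₑ ^ (2 : ℝ) * ‖g (p.1 - p.2)‖ₑ)
      (volume.prod volume) := by
    refine AEMeasurable.mul ?_ ?_
    · exact (hf.1.comp_snd.enorm).pow_const _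
    · exact (hg.1.comp_quasiMeasurePreserving
        (quasiMeasurePreserving_sub volume volume)).enorm
  refine (lintegral_mono hb).trans_lt ?_
  rw [lintegral_mul_const' _ _ hgf.ne, lintegral_lintegral_swap hm2]
  refine ENNReal.mul_lt_top ?_ hgf
  have : ∀ t : ℝ, ∫⁻ x, ‖f t‖ₑ ^ (2 : ℝ) * ‖g (x - t)‖ₑ
      = ‖f t‖ₑ ^ (2 : ℝ) * ∫⁻ x, ‖g x‖ₑ := fun t => by
    rw [lintegral_const_mul', lintegral_sub_right_eq_self (fun x => ‖g x‖ₑ) t]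
    exact (ENNReal.rpow_lt_top_of_nonneg (by norm_num) (by simp)).ne
  simp_rw [this]
  rw [lintegral_mul_const' _ _ hgf.ne]
  exact ENNReal.mul_lt_top hff hgf

theorem memLp_comp_of_growth {s : ℝ → ℝ} (hs : Measurable s)
    (hg : ∃ C : ℝ, ∀ x, |s x| ≤ C * |x|) {f : ℝ → ℝ} (hf : MemLp f 2 volume) :
    MemLp (fun x => s (f x)) 2 volume := by
  obtain ⟨C, hC⟩ := hg
  exact hf.of_le_mul (hs.comp_aemeasurable hf.1.aemeasurable).aestronglyMeasurable
    (Filter.Eventually.of_forall fun x => hC (f x))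

/-- The convolution `f * g ∈ L²(ℝ)` of `f ∈ L²(ℝ)` with an integrable `g`,
`(f * g)(x) = ∫ f(t) g(x - t) dt`. -/
def conv (f g : L2R) (hg : Integrable g volume) : L2R :=
  (memLp_conv (Lp.memLp f) hg).toLp
    (convolution f g (ContinuousLinearMap.lsmul ℝ ℝ) volume)

/-- The pointwise action `f ↦ s ∘ f` on `L²(ℝ)` of a nonlinearity `s` of linear growth. -/
def nonlin (s : ℝ → ℝ) (hs : Measurable s) (hg : ∃ C : ℝ, ∀ x, |s x| ≤ C * |x|)
    (f : L2R) : L2R :=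
  (memLp_comp_of_growth hs hg (Lp.memLp f)).toLp (fun x => s (f x))

/-- `φ_{j,m}(x) = 2^{j/2} φ(2^j x - m)`, as an element of `L²(ℝ)`. -/
def atScale (φ : ℝ → ℝ) (hφ : MemLp φ 2 volume) (j m : ℤ) : L2R :=
  (memLp_affine hφ (zpow_ne_zero j (two_ne_zero' ℝ)) (m : ℝ) ((2 : ℝ) ^ ((j : ℝ) / 2))).toLp
    (fun x => (2 : ℝ) ^ ((j : ℝ) / 2) * φ ((2 : ℝ) ^ j * x - m))

/-! ### Multi-resolution analyses -/

/-- A multi-resolution analysis of `L²(ℝ)` with scaling function `φ`. -/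
structure MRA where
  /-- the scaling spaces -/
  V : ℤ → Submodule ℝ L2R
  /-- the scaling function -/
  φ : ℝ → ℝ
  memLp_φ : MemLp φ 2 volume
  isClosed_V : ∀ j, IsClosed (V j : Set L2R)
  V_le_succ : ∀ j, V j ≤ V (j + 1)
  dense_iUnion : Dense (⋃ j, (V j : Set L2R))
  iInf_eq_bot : ⨅ j, V j = ⊥
  /-- `f ∈ V_j` if and only if `f(2^{-j} ·) ∈ V_0` -/
  mem_V_iff : ∀ (j : ℤ) (f : L2R),
    f ∈ V j ↔ ∃ g ∈ V 0, ∀ᵐ x : ℝ, g x = f ((2 : ℝ) ^ (-j) * x)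
  /-- the integer translates of `φ` form an orthonormal (Hilbert) basis of `V_0` -/
  orthonormal : Orthonormal ℝ (fun m : ℤ => atScale φ memLp_φ 0 m)
  span_eq : (Submodule.span ℝ (Set.range fun m : ℤ =>
    atScale φ memLp_φ 0 m)).topologicalClosure = V 0

namespace MRA

variable (A : MRA)

instance completeSpace_V (j : ℤ) : CompleteSpace (A.V j) :=
  (A.isClosed_V j).completeSpace_coe

/-- The function `φ_{j,m}` of the multi-resolution analysis. -/
def basisFun (j m : ℤ) : L2R := atScale A.φ A.memLp_φ j m

/-- The orthogonal projection of `L²(ℝ)` onto `V_j`. -/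
def proj (j : ℤ) : L2R →L[ℝ] A.V j := (A.V j).orthogonalProjectionOnto

/-- `η_ν(r) = ∫_{ℝ²} φ(t) φ(z) φ(z - 2^ν t + r) dz dt`. -/
def eta (ν : ℕ) (r : ℤ) : ℝ :=
  ∫ p : ℝ × ℝ, A.φ p.1 * A.φ p.2 * A.φ (p.2 - (2 : ℝ) ^ ν * p.1 + r)

/-- The scaling function is compactly supported and bounded, and `η_1` is not identically `0`. -/
structure ScalingHyp : Prop where
  hasCompactSupport : HasCompactSupport A.φ
  bounded : ∃ B : ℝ, ∀ x, |A.φ x| ≤ B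
  eta_ne_zero : ∃ r : ℤ, A.eta 1 r ≠ 0

end MRA

/-! ### Continuous generative neural networks

A network with `L = n + 1` layers; layers are numbered `0, …, n` by `Fin (n + 1)`. Layer `0` is
the fully connected one, and the convolutional layer `l : Fin n` maps layer `l.castSucc` to
layer `l.succ`. -/

/-- The number `2^{n-l}` of channels at layer `l`: it is halved at each convolutional layer, and
equals `1` at the last layer. -/
def channels (n : ℕ) (l : Fin (n + 1)) : ℕ := 2 ^ (n - (l : ℕ))

theorem channels_castSucc {n : ℕ} (l : Fin n) :
    channels n l.castSucc = channels n l.succ + channels n l.succ := by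
  have h : n - (l : ℕ) = (n - ((l : ℕ) + 1)) + 1 := by omega
  simp only [channels, Fin.val_castSucc, Fin.val_succ]
  rw [h, pow_succ]
  ring

theorem channels_last_pos (n : ℕ) : 0 < channels n (Fin.last n) :=
  Nat.two_pow_pos _

/-- The scale `j_1 + l` of layer `l`: convolutions have stride `1/2`. -/
def scale {n : ℕ} (j₁ : ℤ) (l : Fin (n + 1)) : ℤ := j₁ + ((l : ℕ) : ℤ)

/-- The parameters of a continuous generative neural network with latent space `ℝ^S` and
`n + 1` layers. -/
structure CGNN (S n : ℕ) where
  /-- the multi-resolution analysis -/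
  A : MRA
  /-- the scale of the first layer -/
  j₁ : ℤ
  /-- the nonlinearity -/
  σ : ℝ → ℝ
  measurable_σ : Measurable σ
  growth_σ : ∃ C : ℝ, ∀ x, |σ x| ≤ C * |x|
  /-- the linear part of the fully connected layer -/
  F : EuclideanSpace ℝ (Fin S) →ₗ[ℝ] (Fin (channels n 0) → A.V (scale j₁ (0 : Fin (n + 1))))
  /-- the bias of the fully connected layer -/
  b : Fin (channels n 0) → A.V (scale j₁ (0 : Fin (n + 1)))
  /-- the filters `t_{i,k}` of the convolutional layers -/
  t : (l : Fin n) → Fin (channels n l.castSucc) → Fin (channels n l.succ) → A.V (scale j₁ l.succ)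
  integrable_t : ∀ l i k, Integrable ((t l i k : L2R) : ℝ → ℝ) volume
  /-- the biases of the convolutional layers -/
  β : (l : Fin n) → Fin (channels n l.succ) → A.V (scale j₁ l.succ)

namespace CGNN

variable {S n : ℕ} (N : CGNN S n)

/-- The space `(V_{j_l})^{c_l}` of layer `l`. -/
abbrev LayerSpace (l : Fin (n + 1)) : Type := Fin (channels n l) → N.A.V (scale N.j₁ l)

/-- The fully connected layer `z ↦ F z + b`. -/
def fullyConnected (z : EuclideanSpace ℝ (Fin S)) : N.LayerSpace 0 := N.F z + N.b

/-- The nonlinearity at layer `l`, followed by the projection onto `(V_{j_l})^{c_l}`. -/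
def activation (l : Fin (n + 1)) (f : N.LayerSpace l) : N.LayerSpace l := fun k =>
  N.A.proj (scale N.j₁ l) (nonlin N.σ N.measurable_σ N.growth_σ (f k))

/-- The convolutional layer `l`: `k ↦ ∑ᵢ fᵢ * t_{i,k} + β_k`, followed by the projection. -/
def convLayer (l : Fin n) (f : N.LayerSpace l.castSucc) : N.LayerSpace l.succ := fun k =>
  N.A.proj (scale N.j₁ l.succ)
    (∑ i, conv (f i) (N.t l i k) (N.integrable_t l i k) + (N.β l k : L2R))

/-- The output of layer `l`, as a function of the latent variable. -/
def layerOutput (l : Fin (n + 1)) (z : EuclideanSpace ℝ (Fin S)) : N.LayerSpace l :=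
  Fin.induction (motive := fun l => N.LayerSpace l)
    (N.activation 0 (N.fullyConnected z))
    (fun l f => N.activation l.succ (N.convLayer l f)) l

/-- The generator `G : ℝ^S → L²(ℝ)`: the only channel of the output of the last layer. -/
def generator (z : EuclideanSpace ℝ (Fin S)) : L2R :=
  N.layerOutput (Fin.last n) z ⟨0, channels_last_pos n⟩

/-- The square matrix whose columns are those of `(d_{0,i,k})` followed by those of
`(d_{1,i,k})`. -/
def filterMatrix (l : Fin n)
    (d : ℕ → Fin (channels n l.castSucc) → Fin (channels n l.succ) → ℝ) :
    Matrix (Fin (channels n l.castSucc)) (Fin (channels n l.castSucc)) ℝ :=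
  Matrix.of fun i k => Fin.append (d 0 i) (d 1 i) (Fin.cast (channels_castSucc l) k)

/-- The filters are combinations of `φ_{j_l,0}, …, φ_{j_l,p̄}` with a common `p̄` (coefficients
with index `p > p̄` are `0`), and the filter matrices are nonsingular. -/
def FilterHyp : Prop :=
  ∃ (pbar : ℕ)
    (d : (l : Fin n) → ℕ → Fin (channels n l.castSucc) → Fin (channels n l.succ) → ℝ),
    (∀ l p i k, pbar < p → d l p i k = 0) ∧
    (∀ l i k, (N.t l i k : L2R) =
      ∑ p ∈ Finset.range (pbar + 1), d l p i k • N.A.basisFun (scale N.j₁ l.succ) p) ∧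
    ∀ l, (filterMatrix l (d l)).det ≠ 0

/-- `σ` is `C¹`, injective, sign-preserving, and its derivative lies between two positive
constants. -/
structure NonlinearityHyp : Prop where
  contDiff : ContDiff ℝ 1 N.σ
  injective : Function.Injective N.σ
  deriv_bounds : ∃ M₁ M₂ : ℝ, 0 < M₁ ∧ 0 < M₂ ∧ ∀ x, M₁ ≤ deriv N.σ x ∧ deriv N.σ x ≤ M₂
  map_zero : N.σ 0 = 0
  sign : ∀ x, 0 ≤ x * N.σ x

/-- `F` is injective, and `b` and the range of `F` lie in
`(span {φ_{j_1,m} : -R ≤ m ≤ R})^{c_1}` for some `R`. -/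
structure FullyConnectedHyp : Prop where
  injective : Function.Injective N.F
  finite_span : ∃ R : ℕ,
    let W : Submodule ℝ L2R := Submodule.span ℝ
      (N.A.basisFun (scale N.j₁ (0 : Fin (n + 1))) '' Set.Icc (-(R : ℤ)) R)
    (∀ k, (N.b k : L2R) ∈ W) ∧ ∀ z k, (N.F z k : L2R) ∈ W

/-- The manifold `M = G(ℝ^S)`. -/
def manifold : Set L2R := Set.range N.generator

/-- The tangent space to `M = G(ℝ^S)` at `x` in the parametrization `G`: the range of `G'(z)`,
where `G(z) = x`. -/
def tangentSpace (x : L2R) : Submodule ℝ L2R :=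
  ⨆ (z : EuclideanSpace ℝ (Fin S)) (_ : N.generator z = x),
    (fderiv ℝ N.generator z : EuclideanSpace ℝ (Fin S) →ₗ[ℝ] L2R).range

end CGNN

end ContGen

end

/-!
The generator `G` satisfies `‖G z - G w‖ ≥ c ‖z - w‖` for some `c > 0`, and it is strictly
differentiable; so its range is a closed embedded copy of the latent space. Granted this, the
stability estimate on a compact set `K` follows by covering `K × K`
(`exists_norm_sub_le_on_compact`): off the diagonal it is injectivity of `Φ`, and near a diagonal
point it is pulled back to the latent space, where `Φ ∘ G` has an injective strict derivative.

*Lower bound.* The projected nonlinearity `f ↦ P_{V_j}(σ ∘ f)` is strongly monotone, because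
`σ' ≥ M₁ > 0`. The linear part of a convolutional layer is bounded below only on the
finite-dimensional spaces `window j R = span {φ_{j,m} : |m| ≤ R}`, where it suffices to prove
injectivity. In coefficients, the layer with filters `t_{i,k} = ∑_p d_{p,i,k} φ_{j+1,p}` is
`a ↦ c ∑_{i,m,p} a_{i,m} d_{p,i,k} η_1(n - 2m - p)`, where `η_1` has finite support
(`ScalingHyp.exists_inner_conv_basisFun`). If `a ≠ 0` and this vanishes, look at the lowest
nonzero coefficient `a_{·,m}` and the lowest index `r₀` in the support of `η_1`: the outputs
`n = 2m + r₀` and `n = 2m + 1 + r₀` say that `a_{·,m}` is annihilated by the filter matrix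
(`coeff_eq_zero_of_filter_eq_zero`).

The biases are arbitrary elements of `V_j`, so the layer outputs themselves need not have finitely
many coefficients. Their differences do: differences of bounded support are preserved by the
nonlinearity, and `φ` is compactly supported. The induction over the layers
(`CGNN.exists_mul_norm_le_layerOutput`) is therefore carried out for differences.

*Differentiability.* A pointwise nonlinearity is in general not Fréchet differentiable on `L²(ℝ)`.
On `V_j` it is, since a bounded compactly supported `φ` gives `‖f‖_∞ ≤ C ‖f‖_2` for `f ∈ V_j`
(`ScalingHyp.exists_ae_abs_le`) and `σ'` is uniformly continuous on bounded sets. Together with the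
lower bound this makes every `G'(z)` injective.
-/

noncomputable section

namespace ContGen

open Filter Topology

/-! ### Stability on compact subsets of a parametrized manifold -/

/-- A strictly differentiable map with injective derivative on a finite-dimensional space is
bounded below near the point. -/
theorem exists_eventually_norm_sub_le_of_hasStrictFDerivAt {E Y : Type*}
    [NormedAddCommGroup E] [NormedSpace ℝ E] [FiniteDimensional ℝ E]
    [NormedAddCommGroup Y] [NormedSpace ℝ Y] {f : E → Y} {f' : E →L[ℝ] Y} {z : E}
    (hf : HasStrictFDerivAt f f' z) (hinj : Function.Injective f') :
    ∃ C : ℝ, 0 < C ∧ ∀ᶠ p : E × E in 𝓝 (z, z), ‖p.1 - p.2‖ ≤ C * ‖f p.1 - f p.2‖ := by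
  obtain ⟨k, hk, hanti⟩ := LinearMap.exists_antilipschitzWith (f' : E →ₗ[ℝ] Y)
    (LinearMap.ker_eq_bot.2 hinj)
  have hk' : (0 : ℝ) < k := hk
  have hlow : ∀ v, ‖v‖ ≤ k * ‖f' v‖ := fun v => by
    simpa using hanti.le_mul_dist v 0
  refine ⟨2 * k, by positivity, ?_⟩
  filter_upwards [hf.isLittleO.def (c := 1 / (2 * k)) (by positivity)] with p hp
  have h1 := hlow (p.1 - p.2)
  have h2 : ‖f' (p.1 - p.2)‖ ≤ ‖f p.1 - f p.2‖ + ‖f p.1 - f p.2 - f' (p.1 - p.2)‖ := by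
    have := norm_sub_le (f p.1 - f p.2) (f p.1 - f p.2 - f' (p.1 - p.2))
    rwa [sub_sub_cancel] at this
  have h3 : k * (1 / (2 * k) * ‖p.1 - p.2‖) = ‖p.1 - p.2‖ / 2 := by
    field_simp
  nlinarith [mul_le_mul_of_nonneg_left (h2.trans (add_le_add_right hp _)) hk'.le]

/-- Lipschitz stability on compact subsets of a parametrized manifold. Away from the diagonal of
`K × K` the estimate follows from injectivity of `Φ`. Near a diagonal point `(G z, G z)` it is
pulled back to the parameter space, where `Φ ∘ G` has an injective strict derivative; the lower
bound on `G` guarantees that points of the manifold close to `G z` have parameters close to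
`z`. -/
theorem exists_norm_sub_le_on_compact {E H Y : Type*}
    [NormedAddCommGroup E] [NormedSpace ℝ E] [FiniteDimensional ℝ E]
    [NormedAddCommGroup H] [NormedSpace ℝ H] [NormedAddCommGroup Y] [NormedSpace ℝ Y]
    {G : E → H} {G' : E → E →L[ℝ] H} {c : ℝ} (hc : 0 < c)
    (hlow : ∀ z w, c * ‖z - w‖ ≤ ‖G z - G w‖) (hG : ∀ z, HasStrictFDerivAt G (G' z) z)
    {Φ : H → Y} (hΦ : ContDiff ℝ 1 Φ) (hΦinj : Function.Injective Φ)
    (hinj : ∀ z, Function.Injective ((fderiv ℝ Φ (G z)).comp (G' z)))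
    {K : Set H} (hK : IsCompact K) (hKG : K ⊆ Set.range G) :
    ∃ C : ℝ, 0 < C ∧ ∀ x ∈ K, ∀ y ∈ K, ‖x - y‖ ≤ C * ‖Φ x - Φ y‖ := by
  suffices h : ∃ C : ℝ, 0 < C ∧ ∀ p ∈ K ×ˢ K, ‖p.1 - p.2‖ ≤ C * ‖Φ p.1 - Φ p.2‖ by
    obtain ⟨C, hC, h⟩ := h
    exact ⟨C, hC, fun x hx y hy => h (x, y) ⟨hx, hy⟩⟩
  refine (hK.prod hK).induction_on
    (p := fun s => ∃ C : ℝ, 0 < C ∧ ∀ p ∈ s, ‖p.1 - p.2‖ ≤ C * ‖Φ p.1 - Φ p.2‖)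
    ⟨1, one_pos, by simp⟩ ?_ ?_ ?_
  · rintro s t hst ⟨C, hC, h⟩
    exact ⟨C, hC, fun p hp => h p (hst hp)⟩
  · rintro s t ⟨C, hC, h⟩ ⟨D, hD, h'⟩
    refine ⟨max C D, lt_max_of_lt_left hC, ?_⟩
    rintro p (hp | hp)
    · exact (h p hp).trans (by gcongr; exact le_max_left _ _)
    · exact (h' p hp).trans (by gcongr; exact le_max_right _ _)
  rintro ⟨x, y⟩ ⟨hx, hy⟩
  have hΦc := hΦ.continuous
  obtain rfl | hxy := eq_or_ne x y
  · obtain ⟨z, rfl⟩ := hKG hx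
    obtain ⟨C, hC, hev⟩ := exists_eventually_norm_sub_le_of_hasStrictFDerivAt
      ((hΦ.contDiffAt.hasStrictFDerivAt one_ne_zero).comp z (hG z)) (hinj z)
    obtain ⟨k, s, hs, hLip⟩ := (hG z).exists_lipschitzOnWith
    have hev' : ∀ᶠ p : E × E in 𝓝 (z, z),
        ‖G p.1 - G p.2‖ ≤ ((k + 1) * C) * ‖Φ (G p.1) - Φ (G p.2)‖ := by
      filter_upwards [hev, prod_mem_nhds hs hs] with p hp hps
      have h1 := hLip.dist_le_mul _ hps.1 _ hps.2
      rw [dist_eq_norm, dist_eq_norm] at h1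
      have : (0 : ℝ) ≤ k := k.2
      calc ‖G p.1 - G p.2‖ ≤ (k + 1) * ‖p.1 - p.2‖ := by nlinarith [norm_nonneg (p.1 - p.2)]
        _ ≤ (k + 1) * (C * ‖Φ (G p.1) - Φ (G p.2)‖) := by gcongr
        _ = _ := by ring
    obtain ⟨δ, hδ, hball⟩ := Metric.eventually_nhds_iff_ball.1 hev'
    refine ⟨(Metric.ball (G z, G z) (c * δ)) ∩ K ×ˢ K,
      Filter.inter_mem (mem_nhdsWithin_of_mem_nhds (Metric.ball_mem_nhds _ (by positivity)))
        self_mem_nhdsWithin, (k + 1) * C, by positivity, ?_⟩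
    rintro ⟨u, v⟩ ⟨hball', hu, hv⟩
    obtain ⟨a, rfl⟩ := hKG hu
    obtain ⟨b, rfl⟩ := hKG hv
    have key : ∀ a, dist (G a) (G z) < c * δ → dist a z < δ := fun a ha => by
      rw [dist_eq_norm] at ha ⊢
      exact lt_of_mul_lt_mul_left ((hlow a z).trans_lt ha) hc.le
    rw [← ball_prod_same] at hball'
    refine hball (a, b) ?_
    rw [← ball_prod_same]
    exact ⟨key a hball'.1, key b hball'.2⟩
  · have hpos : 0 < ‖Φ x - Φ y‖ := norm_pos_iff.2 (sub_ne_zero.2 (hΦinj.ne hxy))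
    have hq : ContinuousAt (fun p : H × H => ‖p.1 - p.2‖ / ‖Φ p.1 - Φ p.2‖) (x, y) := by
      refine ContinuousAt.div (by fun_prop) (by fun_prop) hpos.ne'
    have hn : ContinuousAt (fun p : H × H => ‖Φ p.1 - Φ p.2‖) (x, y) := by fun_prop
    refine ⟨_, mem_nhdsWithin_of_mem_nhds
      ((hq.eventually_lt_const (lt_add_one _)).and (hn.eventually_const_lt hpos)),
      ‖x - y‖ / ‖Φ x - Φ y‖ + 1, by positivity, ?_⟩
    rintro p ⟨h1, h2⟩
    exact ((div_lt_iff₀ h2).1 h1).le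

/-! ### Dilations, bases of the scaling spaces, and the supremum norm -/

theorem quasiMeasurePreserving_const_mul {a : ℝ} (ha : a ≠ 0) :
    Measure.QuasiMeasurePreserving (fun x : ℝ => a * x) volume volume := by
  refine ⟨measurable_const_mul a, ?_⟩
  rw [Real.map_volume_mul_left ha]
  exact Measure.smul_absolutelyContinuous

theorem coeFn_sum_smul {ι : Type*} (s : Finset ι) (a : ι → ℝ) (f : ι → L2R) :
    ⇑(∑ i ∈ s, a i • f i) =ᵐ[volume] fun x => ∑ i ∈ s, a i * f i x := by
  classical
  induction s using Finset.induction_on with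
  | empty =>
    filter_upwards [Lp.coeFn_zero ℝ 2 (volume : Measure ℝ)] with x hx
    simp
  | insert i s hi ih =>
    rw [Finset.sum_insert hi]
    filter_upwards [ih, Lp.coeFn_add (a i • f i) (∑ i ∈ s, a i • f i),
      Lp.coeFn_smul (a i) (f i)] with x h1 h2 h3
    rw [h2, Pi.add_apply, h3, h1, Finset.sum_insert hi, Pi.smul_apply, smul_eq_mul]

/-- The unitary dilation `f ↦ 2^{j/2} f(2^j ·)` of `L²(ℝ)`, as a linear isometry. -/
def dilation (j : ℤ) : L2R →ₗᵢ[ℝ] L2R where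
  toFun f := (memLp_affine (Lp.memLp f) (zpow_ne_zero j (two_ne_zero' ℝ)) 0
    ((2 : ℝ) ^ ((j : ℝ) / 2))).toLp (fun x => (2 : ℝ) ^ ((j : ℝ) / 2) * f ((2 : ℝ) ^ j * x - 0))
  map_add' f g := by
    rw [← MemLp.toLp_add]
    refine MemLp.toLp_congr _ _ ?_
    filter_upwards [(quasiMeasurePreserving_const_mul (zpow_ne_zero j (two_ne_zero' ℝ))).ae
      (Lp.coeFn_add f g)] with x hx
    simp only [sub_zero] at hx ⊢
    rw [hx, Pi.add_apply, Pi.add_apply, mul_add]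
  map_smul' c f := by
    rw [RingHom.id_apply, ← MemLp.toLp_const_smul]
    refine MemLp.toLp_congr _ _ ?_
    filter_upwards [(quasiMeasurePreserving_const_mul (zpow_ne_zero j (two_ne_zero' ℝ))).ae
      (Lp.coeFn_smul c f)] with x hx
    simp only [sub_zero, Pi.smul_apply] at hx ⊢
    rw [hx, smul_eq_mul, smul_eq_mul]
    ring
  norm_map' f := by
    have hpos : (0 : ℝ) < (2 : ℝ) ^ j := by positivity
    have hsq : ((2 : ℝ) ^ ((j : ℝ) / 2)) ^ 2 = (2 : ℝ) ^ j := by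
      rw [← Real.rpow_natCast, ← Real.rpow_mul (by norm_num), ← Real.rpow_intCast]
      norm_num
    rw [← sq_eq_sq₀ (norm_nonneg _) (norm_nonneg _), ← real_inner_self_eq_norm_sq,
      ← real_inner_self_eq_norm_sq, L2.inner_def, L2.inner_def]
    have h1 : ∀ᵐ x : ℝ, inner ℝ
        (((memLp_affine (Lp.memLp f) (zpow_ne_zero j (two_ne_zero' ℝ)) 0
          ((2 : ℝ) ^ ((j : ℝ) / 2))).toLp _ : L2R) x)
        (((memLp_affine (Lp.memLp f) (zpow_ne_zero j (two_ne_zero' ℝ)) 0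
          ((2 : ℝ) ^ ((j : ℝ) / 2))).toLp _ : L2R) x)
        = (2 : ℝ) ^ j * (fun y => f y * f y) ((2 : ℝ) ^ j * x) := by
      filter_upwards [MemLp.coeFn_toLp (memLp_affine (Lp.memLp f)
        (zpow_ne_zero j (two_ne_zero' ℝ)) 0 ((2 : ℝ) ^ ((j : ℝ) / 2)))] with x hx
      rw [hx, sub_zero, real_inner_self_eq_norm_sq, Real.norm_eq_abs, sq_abs, mul_pow, hsq,
        sq (f _)]
    refine (integral_congr_ae h1).trans ?_
    rw [integral_const_mul, Measure.integral_comp_mul_left (fun y => f y * f y),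
      abs_of_pos (inv_pos.2 hpos), smul_eq_mul, mul_inv_cancel_left₀ hpos.ne']
    rfl

theorem dilation_coeFn (j : ℤ) (f : L2R) :
    ⇑(dilation j f) =ᵐ[volume] fun x => (2 : ℝ) ^ ((j : ℝ) / 2) * f ((2 : ℝ) ^ j * x) := by
  filter_upwards [MemLp.coeFn_toLp (memLp_affine (Lp.memLp f)
    (zpow_ne_zero j (two_ne_zero' ℝ)) 0 ((2 : ℝ) ^ ((j : ℝ) / 2)))] with x hx
  rw [sub_zero] at hx
  exact hx

namespace MRA

variable (A : MRA)

theorem basisFun_coeFn (j m : ℤ) : ⇑(A.basisFun j m) =ᵐ[volume]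
    fun x => (2 : ℝ) ^ ((j : ℝ) / 2) * A.φ ((2 : ℝ) ^ j * x - m) :=
  MemLp.coeFn_toLp (memLp_affine A.memLp_φ (zpow_ne_zero j (two_ne_zero' ℝ)) (m : ℝ) _)

theorem dilation_basisFun (j m : ℤ) : dilation j (A.basisFun 0 m) = A.basisFun j m := by
  refine Lp.ext ?_
  filter_upwards [dilation_coeFn j (A.basisFun 0 m), A.basisFun_coeFn j m,
    (quasiMeasurePreserving_const_mul (zpow_ne_zero j (two_ne_zero' ℝ))).ae
      (A.basisFun_coeFn 0 m)] with x h1 h2 h3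
  simp [h1, h2, h3]

theorem mem_V_iff_exists_dilation (j : ℤ) (f : L2R) :
    f ∈ A.V j ↔ ∃ g ∈ A.V 0, dilation j g = f := by
  have h2 : (2 : ℝ) ^ ((j : ℝ) / 2) ≠ 0 := (Real.rpow_pos_of_pos two_pos _).ne'
  have hj : (2 : ℝ) ^ j ≠ 0 := zpow_ne_zero j two_ne_zero
  have hj' : (2 : ℝ) ^ (-j) ≠ 0 := zpow_ne_zero _ two_ne_zero
  rw [A.mem_V_iff]
  constructor
  · rintro ⟨g, hg, h⟩
    refine ⟨((2 : ℝ) ^ ((j : ℝ) / 2))⁻¹ • g, (A.V 0).smul_mem _ hg, Lp.ext ?_⟩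
    rw [map_smul]
    filter_upwards [dilation_coeFn j g, Lp.coeFn_smul ((2 : ℝ) ^ ((j : ℝ) / 2))⁻¹ (dilation j g),
      (quasiMeasurePreserving_const_mul hj).ae h] with x h1 h3 h4
    rw [h3, Pi.smul_apply, h1, h4, smul_eq_mul, inv_mul_cancel_left₀ h2, ← mul_assoc, zpow_neg,
      inv_mul_cancel₀ hj, one_mul]
  · rintro ⟨g, hg, rfl⟩
    refine ⟨(2 : ℝ) ^ ((j : ℝ) / 2) • g, (A.V 0).smul_mem _ hg, ?_⟩
    filter_upwards [(quasiMeasurePreserving_const_mul hj').ae (dilation_coeFn j g),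
      Lp.coeFn_smul ((2 : ℝ) ^ ((j : ℝ) / 2)) g] with x h1 h3
    rw [h1, h3, Pi.smul_apply, smul_eq_mul, ← mul_assoc ((2 : ℝ) ^ j), zpow_neg,
      mul_inv_cancel₀ hj, one_mul]

theorem orthonormal_basisFun (j : ℤ) : Orthonormal ℝ (A.basisFun j) := by
  have := A.orthonormal.comp_linearIsometry (dilation j)
  convert this using 1
  funext m
  exact (A.dilation_basisFun j m).symm

theorem basisFun_mem_V (j m : ℤ) : A.basisFun j m ∈ A.V j := by
  refine (A.mem_V_iff_exists_dilation j _).2 ⟨A.basisFun 0 m, ?_, A.dilation_basisFun j m⟩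
  rw [← A.span_eq]
  exact Submodule.le_topologicalClosure _ (Submodule.subset_span ⟨m, rfl⟩)

theorem eq_zero_of_inner_basisFun_eq_zero {j : ℤ} {f : L2R} (hf : f ∈ A.V j)
    (h : ∀ m, inner ℝ (A.basisFun j m) f = 0) : f = 0 := by
  obtain ⟨g, hg, rfl⟩ := (A.mem_V_iff_exists_dilation j f).1 hf
  have hle : A.V 0 ≤ (ℝ ∙ g)ᗮ := by
    rw [← A.span_eq]
    refine Submodule.topologicalClosure_minimal _ (Submodule.span_le.2 ?_)
      (Submodule.isClosed_orthogonal _)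
    rintro _ ⟨m, rfl⟩
    refine Submodule.mem_orthogonal_singleton_iff_inner_left.2 ?_
    rw [← h m, ← A.dilation_basisFun, LinearIsometry.inner_map_map]
    rfl
  have h0 : inner ℝ g g = 0 := Submodule.mem_orthogonal_singleton_iff_inner_left.1 (hle hg)
  rw [inner_self_eq_zero.1 h0, map_zero]

/-- The finite-dimensional space spanned by the functions `φ_{j,m}` with `|m| ≤ R`. -/
def window (j : ℤ) (R : ℕ) : Submodule ℝ L2R :=
  Submodule.span ℝ (A.basisFun j '' Set.Icc (-(R : ℤ)) R)

instance (j : ℤ) (R : ℕ) : FiniteDimensional ℝ (A.window j R) :=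
  FiniteDimensional.span_of_finite ℝ ((Set.finite_Icc _ _).image _)

theorem inner_basisFun_proj (j m : ℤ) (h : L2R) :
    inner ℝ (A.basisFun j m) (A.proj j h : L2R) = inner ℝ (A.basisFun j m) h :=
  Submodule.inner_orthogonalProjectionOnto_eq_of_mem_left ⟨_, A.basisFun_mem_V j m⟩ h

theorem eq_sum_of_inner_eq_zero {j : ℤ} {R : ℕ} {f : L2R} (hf : f ∈ A.V j)
    (h : ∀ m : ℤ, (R : ℤ) < |m| → inner ℝ (A.basisFun j m) f = 0) :
    f = ∑ m ∈ Finset.Icc (-(R : ℤ)) R, (inner ℝ (A.basisFun j m) f : ℝ) • A.basisFun j m := by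
  rw [← sub_eq_zero]
  refine A.eq_zero_of_inner_basisFun_eq_zero (j := j) (Submodule.sub_mem _ hf
    (Submodule.sum_mem _ fun m _ => Submodule.smul_mem _ _ (A.basisFun_mem_V j m))) fun m => ?_
  rw [inner_sub_right]
  by_cases hm : m ∈ Finset.Icc (-(R : ℤ)) R
  · rw [(A.orthonormal_basisFun j).inner_right_sum _ hm, sub_self]
  · rw [h m (by rw [Finset.mem_Icc, ← abs_le] at hm; omega), inner_sum, Finset.sum_eq_zero,
      sub_zero]
    intro i hi
    rw [inner_smul_right, (A.orthonormal_basisFun j).2 (by rintro rfl; exact hm hi), mul_zero]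

theorem mem_window_of_inner_eq_zero {j : ℤ} {R : ℕ} {f : L2R} (hf : f ∈ A.V j)
    (h : ∀ m : ℤ, (R : ℤ) < |m| → inner ℝ (A.basisFun j m) f = 0) : f ∈ A.window j R := by
  rw [A.eq_sum_of_inner_eq_zero hf h]
  refine Submodule.sum_mem _ fun m hm => Submodule.smul_mem _ _ (Submodule.subset_span ⟨m, ?_, rfl⟩)
  simpa using hm

theorem inner_eq_zero_of_mem_window {j : ℤ} {R : ℕ} {f : L2R} (hf : f ∈ A.window j R) (m : ℤ)
    (hm : (R : ℤ) < |m|) : inner ℝ (A.basisFun j m) f = 0 := by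
  have hle : A.window j R ≤ (ℝ ∙ A.basisFun j m)ᗮ := by
    refine Submodule.span_le.2 ?_
    rintro _ ⟨i, hi, rfl⟩
    refine Submodule.mem_orthogonal_singleton_iff_inner_right.2 ?_
    refine (A.orthonormal_basisFun j).2 ?_
    rintro rfl
    rw [Set.mem_Icc, ← abs_le] at hi
    omega
  exact Submodule.mem_orthogonal_singleton_iff_inner_right.1 (hle hf)

variable {A}

theorem ScalingHyp.exists_support_bound (hA : A.ScalingHyp) :
    ∃ ρ : ℝ, 0 < ρ ∧ ∀ x, ρ < |x| → A.φ x = 0 := by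
  obtain ⟨ρ, hρ, h⟩ := hA.hasCompactSupport.isCompact.isBounded.exists_pos_norm_le
  refine ⟨ρ, hρ, fun x hx => ?_⟩
  by_contra hne
  exact absurd (h x (subset_tsupport _ hne)) (not_le.2 hx)

/-- Elements of a window have a common bounded support. -/
theorem ScalingHyp.exists_window_support (hA : A.ScalingHyp) (j : ℤ) (R : ℕ) :
    ∃ a : ℝ, ∀ f ∈ A.window j R, ∀ᵐ x : ℝ, a < |x| → f x = 0 := by
  obtain ⟨ρ, hρ, hφ⟩ := hA.exists_support_bound
  have hpos : (0 : ℝ) < (2 : ℝ) ^ j := by positivity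
  refine ⟨((2 : ℝ) ^ j)⁻¹ * (ρ + R), fun f hf => ?_⟩
  induction hf using Submodule.span_induction with
  | mem f hf =>
    obtain ⟨m, hm, rfl⟩ := hf
    filter_upwards [A.basisFun_coeFn j m] with x hx hlt
    rw [hx, hφ, mul_zero]
    rw [inv_mul_lt_iff₀ hpos] at hlt
    have h1 : |(m : ℝ)| ≤ R := by
      rw [abs_le]; exact ⟨by exact_mod_cast hm.1, by exact_mod_cast hm.2⟩
    have h2 := abs_sub_abs_le_abs_sub ((2 : ℝ) ^ j * x) m
    rw [abs_mul, abs_of_pos hpos] at h2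
    linarith
  | zero =>
    filter_upwards [Lp.coeFn_zero ℝ 2 (volume : Measure ℝ)] with x hx _
    simp
  | add f g _ _ h1 h2 =>
    filter_upwards [h1, h2, Lp.coeFn_add f g] with x h1 h2 h3 hlt
    rw [h3, Pi.add_apply, h1 hlt, h2 hlt, add_zero]
  | smul c f _ h1 =>
    filter_upwards [h1, Lp.coeFn_smul c f] with x h1 h3 hlt
    simp [h3, h1 hlt]

/-- A function of bounded support is orthogonal to all but finitely many of the `φ_{j,m}`. -/
theorem ScalingHyp.exists_inner_eq_zero (hA : A.ScalingHyp) (j : ℤ) (a : ℝ) :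
    ∃ R : ℕ, ∀ f : L2R, (∀ᵐ x : ℝ, a < |x| → f x = 0) →
      ∀ m : ℤ, (R : ℤ) < |m| → inner ℝ (A.basisFun j m) f = 0 := by
  obtain ⟨ρ, hρ, hφ⟩ := hA.exists_support_bound
  have hpos : (0 : ℝ) < (2 : ℝ) ^ j := by positivity
  refine ⟨⌈ρ + (2 : ℝ) ^ j * a⌉₊, fun f hf m hm => ?_⟩
  rw [L2.inner_def]
  refine integral_eq_zero_of_ae ?_
  filter_upwards [hf, A.basisFun_coeFn j m] with x h1 h2
  by_cases hx : a < |x|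
  · simp [h1 hx]
  · rw [h2, hφ]
    · simp
    have h3 : ρ + (2 : ℝ) ^ j * a < |(m : ℝ)| :=
      (Nat.le_ceil _).trans_lt (by exact_mod_cast hm)
    have h4 := abs_sub_abs_le_abs_sub (m : ℝ) ((2 : ℝ) ^ j * x)
    rw [abs_mul, abs_of_pos hpos, abs_sub_comm] at h4
    nlinarith

theorem isClosed_setOf_ae_abs_le_mul_norm (C : ℝ) :
    IsClosed {f : L2R | ∀ᵐ x : ℝ, |f x| ≤ C * ‖f‖} := by
  -- A subsequence of an `L²`-convergent sequence converges almost everywhere.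
  refine IsSeqClosed.isClosed ?_
  intro u f hu hf
  obtain ⟨k, hk, hae⟩ := (tendstoInMeasure_of_tendsto_Lp hf).exists_seq_tendsto_ae
  filter_upwards [hae, ae_all_iff.2 hu] with x h1 h2
  exact le_of_tendsto_of_tendsto' h1.abs
    ((hf.comp hk.tendsto_atTop).norm.const_mul C) fun n => h2 (k n)

/-- The spaces `V_j` embed in `L^∞(ℝ)`: only boundedly many of the translates of `φ` are nonzero
at a given point. -/
theorem ScalingHyp.exists_ae_abs_le (hA : A.ScalingHyp) (j : ℤ) :
    ∃ C : ℝ, 0 < C ∧ ∀ f ∈ A.V j, ∀ᵐ x : ℝ, |f x| ≤ C * ‖f‖ := by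
  obtain ⟨ρ, hρ, hφ⟩ := hA.exists_support_bound
  obtain ⟨B, hB⟩ := hA.bounded
  have hB0 : 0 ≤ B := (abs_nonneg _).trans (hB 0)
  -- At most `2ρ + 1` integers `m` satisfy `|x - m| ≤ ρ`.
  have hsum : ∀ (x : ℝ) (s : Finset ℤ), ∑ m ∈ s, A.φ (x - m) ^ 2 ≤ (2 * ρ + 1) * B ^ 2 := by
    intro x s
    have hsub : ∀ m ∈ s, A.φ (x - m) ^ 2 ≠ 0 → m ∈ Finset.Icc ⌈x - ρ⌉ ⌊x + ρ⌋ := by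
      intro m _ hm
      have : |x - m| ≤ ρ := by
        by_contra hlt
        exact hm (by rw [hφ _ (not_le.1 hlt)]; simp)
      rw [abs_le] at this
      rw [Finset.mem_Icc, Int.ceil_le, Int.le_floor]
      constructor <;> linarith
    rw [← Finset.sum_filter_of_ne hsub]
    refine (Finset.sum_le_card_nsmul _ _ (B ^ 2) fun m _ => sq_le_sq' ?_ ?_).trans ?_
    · exact (abs_le.1 (hB _)).1
    · exact (abs_le.1 (hB _)).2
    rw [nsmul_eq_mul]
    gcongr
    have h1 : (s.filter fun m => m ∈ Finset.Icc ⌈x - ρ⌉ ⌊x + ρ⌋).card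
        ≤ (⌊x + ρ⌋ + 1 - ⌈x - ρ⌉).toNat := by
      rw [← Int.card_Icc]
      exact Finset.card_le_card fun m hm => (Finset.mem_filter.1 hm).2
    refine (Nat.cast_le.2 h1).trans ?_
    rcases le_total 0 (⌊x + ρ⌋ + 1 - ⌈x - ρ⌉) with h0 | h0
    · have : (((⌊x + ρ⌋ + 1 - ⌈x - ρ⌉).toNat : ℤ) : ℝ) = ((⌊x + ρ⌋ + 1 - ⌈x - ρ⌉ : ℤ) : ℝ) := by
        rw [Int.toNat_of_nonneg h0]
      rw [Int.cast_natCast] at this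
      rw [this]
      push_cast
      linarith [Int.floor_le (x + ρ), Int.le_ceil (x - ρ)]
    · rw [Int.toNat_of_nonpos h0]
      simp
      positivity
  set D : ℝ := √((2 * ρ + 1) * B ^ 2) with hD
  -- Cauchy–Schwarz for finite combinations of translates, then density in `V_0`.
  have h0 : ∀ f ∈ A.V 0, ∀ᵐ x : ℝ, |f x| ≤ D * ‖f‖ := by
    intro f hf
    rw [← A.span_eq, ← SetLike.mem_coe, Submodule.topologicalClosure_coe] at hf
    refine closure_minimal ?_ (isClosed_setOf_ae_abs_le_mul_norm D) hf
    intro g hg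
    obtain ⟨c, rfl⟩ := Finsupp.mem_span_range_iff_exists_finsupp.1 hg
    filter_upwards [coeFn_sum_smul c.support c (A.basisFun 0),
      ae_all_iff.2 (A.basisFun_coeFn 0)] with x h1 h2
    have hn : ‖(c.sum fun i a => a • atScale A.φ A.memLp_φ 0 i : L2R)‖ ^ 2
        = ∑ m ∈ c.support, c m ^ 2 := by
      rw [← real_inner_self_eq_norm_sq, Finsupp.sum, A.orthonormal.inner_sum]
      simp [sq]
    have hx : (c.sum fun i a => a • atScale A.φ A.memLp_φ 0 i : L2R) x
        = ∑ m ∈ c.support, c m * A.φ (x - m) := by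
      refine h1.trans (Finset.sum_congr rfl fun m _ => ?_)
      rw [h2]
      simp
    rw [hx]
    refine abs_le_of_sq_le_sq ?_ (by positivity)
    rw [mul_pow, hn, hD, Real.sq_sqrt (by positivity), mul_comm]
    refine (Finset.sum_mul_sq_le_sq_mul_sq _ _ _).trans ?_
    gcongr
    exact hsum x _
  refine ⟨(2 : ℝ) ^ ((j : ℝ) / 2) * (D + 1), by positivity, fun f hf => ?_⟩
  obtain ⟨g, hg, rfl⟩ := (A.mem_V_iff_exists_dilation j f).1 hf
  filter_upwards [dilation_coeFn j g, (quasiMeasurePreserving_const_mul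
    (zpow_ne_zero j (two_ne_zero' ℝ))).ae (h0 g hg)] with x h1 h2
  rw [h1, abs_mul, LinearIsometry.norm_map, abs_of_pos (Real.rpow_pos_of_pos two_pos _), mul_assoc]
  gcongr
  nlinarith [norm_nonneg g]

end MRA

/-! ### Convolution in `L²(ℝ)` and its coefficients -/

/-- The value at `x` of the convolution of two elements of `L²(ℝ)`, as the inner product of the
first factor with the reflected and translated second factor. -/
def convAt (x : ℝ) (f g : L2R) : ℝ :=
  inner ℝ f (Lp.compMeasurePreservingₗᵢ ℝ (fun t => x - t)
    (Measure.measurePreserving_sub_left volume x) g)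

theorem convAt_sum_smul {ι κ : Type*} (x : ℝ) (s : Finset ι) (a : ι → ℝ) (f : ι → L2R)
    (u : Finset κ) (d : κ → ℝ) (g : κ → L2R) :
    convAt x (∑ i ∈ s, a i • f i) (∑ p ∈ u, d p • g p) =
      ∑ i ∈ s, ∑ p ∈ u, a i * d p * convAt x (f i) (g p) := by
  simp only [convAt, map_sum, map_smul, sum_inner, inner_sum, inner_smul_left, inner_smul_right,
    conj_trivial, mul_assoc, Finset.mul_sum]
  rw [Finset.sum_comm]
  simp only [mul_left_comm]

theorem convolution_eq_convAt (f g : L2R) (x : ℝ) :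
    convolution f g (ContinuousLinearMap.lsmul ℝ ℝ) volume x = convAt x f g := by
  rw [convAt, L2.inner_def]
  refine integral_congr_ae ?_
  filter_upwards [Lp.coeFn_compMeasurePreserving g
    (Measure.measurePreserving_sub_left volume x)] with t ht
  have : (Lp.compMeasurePreservingₗᵢ ℝ (fun t => x - t)
    (Measure.measurePreserving_sub_left volume x) g) t = g (x - t) := ht
  rw [this]
  simp [mul_comm]

theorem conv_coeFn (f g : L2R) (hg : Integrable g volume) :
    ⇑(conv f g hg) =ᵐ[volume] fun x => convAt x f g := by
  filter_upwards [MemLp.coeFn_toLp (memLp_conv (Lp.memLp f) hg)] with x hx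
  rw [← convolution_eq_convAt, ← hx]
  rfl

/-- Convolution with an integrable element of `L²(ℝ)`, as a linear map. -/
def convLinear (g : L2R) (hg : Integrable g volume) : L2R →ₗ[ℝ] L2R where
  toFun f := conv f g hg
  map_add' f h := by
    refine Lp.ext ?_
    filter_upwards [conv_coeFn (f + h) g hg, conv_coeFn f g hg, conv_coeFn h g hg,
      Lp.coeFn_add (conv f g hg) (conv h g hg)] with x h1 h2 h3 h4
    rw [h1, h4, Pi.add_apply, h2, h3, convAt, inner_add_left]
    rfl
  map_smul' c f := by
    refine Lp.ext ?_
    filter_upwards [conv_coeFn (c • f) g hg, conv_coeFn f g hg,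
      Lp.coeFn_smul c (conv f g hg)] with x h1 h2 h4
    rw [RingHom.id_apply, h1, h4, Pi.smul_apply, h2, convAt, real_inner_smul_left]
    rfl

/-- Convolution with an integrable element of `L²(ℝ)`, as a continuous linear map. Continuity
follows from the closed graph theorem, as `f ↦ (f * g)(x)` is continuous for every `x`. -/
def convCLM (g : L2R) (hg : Integrable g volume) : L2R →L[ℝ] L2R where
  toLinearMap := convLinear g hg
  cont := by
    refine LinearMap.continuous_of_seq_closed_graph (g := convLinear g hg) ?_
    intro u f h hu hh
    obtain ⟨k, hk, hae⟩ := (tendstoInMeasure_of_tendsto_Lp hh).exists_seq_tendsto_ae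
    refine Lp.ext ?_
    filter_upwards [hae, conv_coeFn f g hg, ae_all_iff.2 fun n => conv_coeFn (u n) g hg]
      with x h1 h2 h3
    refine tendsto_nhds_unique h1 ?_
    have h4 : Tendsto (fun n => convAt x (u (k n)) g) atTop (𝓝 (convAt x f g)) :=
      (hu.comp hk.tendsto_atTop).inner tendsto_const_nhds
    rw [← h2] at h4
    exact h4.congr fun n => (h3 (k n)).symm

theorem convCLM_apply (g : L2R) (hg : Integrable g volume) (f : L2R) :
    convCLM g hg f = conv f g hg := rfl

theorem conv_sum_smul {ι κ : Type*} (s : Finset ι) (a : ι → ℝ) (f : ι → L2R)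
    (u : Finset κ) (d : κ → ℝ) (g : κ → L2R) (hg : ∀ p, Integrable (g p) volume)
    (h : Integrable (∑ p ∈ u, d p • g p : L2R) volume) :
    conv (∑ i ∈ s, a i • f i) (∑ p ∈ u, d p • g p) h =
      ∑ q ∈ s ×ˢ u, (a q.1 * d q.2) • conv (f q.1) (g q.2) (hg q.2) := by
  refine Lp.ext ?_
  have hall : ∀ᵐ x : ℝ, ∀ q ∈ s ×ˢ u,
      conv (f q.1) (g q.2) (hg q.2) x = convAt x (f q.1) (g q.2) :=
    (ae_ball_iff (s ×ˢ u).countable_toSet).2 fun q _ => conv_coeFn _ _ _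
  filter_upwards [conv_coeFn _ _ h, hall, coeFn_sum_smul (s ×ˢ u) (fun q => a q.1 * d q.2)
    (fun q => conv (f q.1) (g q.2) (hg q.2))] with x h1 h2 h3
  rw [h1, h3, convAt_sum_smul, Finset.sum_product' s u
    (fun i p => a i * d p * conv (f i) (g p) (hg p) x)]
  exact Finset.sum_congr rfl fun i hi => Finset.sum_congr rfl fun p hp => by
    rw [h2 (i, p) (Finset.mk_mem_product hi hp)]

theorem integral_comp_mul_sub (f : ℝ → ℝ) (a m : ℝ) :
    ∫ x : ℝ, f (a * x - m) = |a⁻¹| * ∫ x : ℝ, f x := by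
  rw [Measure.integral_comp_mul_left (fun y => f (y - m)), integral_sub_right_eq_self, smul_eq_mul]

namespace MRA

variable {A : MRA}

theorem ScalingHyp.integrable_φ (hA : A.ScalingHyp) : Integrable A.φ volume := by
  obtain ⟨B, hB⟩ := hA.bounded
  rw [← integrableOn_iff_integrable_of_support_subset (subset_tsupport A.φ)]
  exact Measure.integrableOn_of_bounded hA.hasCompactSupport.isCompact.measure_lt_top.ne
    A.memLp_φ.1 (M := B) (Eventually.of_forall hB)

theorem ScalingHyp.integrable_basisFun (hA : A.ScalingHyp) (j m : ℤ) :
    Integrable (A.basisFun j m) volume := by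
  refine Integrable.congr ?_ (A.basisFun_coeFn j m).symm
  exact (((hA.integrable_φ.comp_sub_right (m : ℝ)).comp_mul_left'
    (zpow_ne_zero j (two_ne_zero' ℝ))).const_mul _)

theorem ScalingHyp.integrable_eta (hA : A.ScalingHyp) (r : ℝ) :
    Integrable (fun p : ℝ × ℝ => A.φ p.1 * A.φ p.2 * A.φ (p.2 - 2 * p.1 + r))
      (volume.prod volume) := by
  obtain ⟨B, hB⟩ := hA.bounded
  refine (hA.integrable_φ.mul_prod hA.integrable_φ).mul_bdd (c := B) ?_ (Eventually.of_forall
    fun p => hB _)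
  refine A.memLp_φ.1.comp_quasiMeasurePreserving
    (QuasiMeasurePreserving.prod_of_right (by fun_prop) (Eventually.of_forall fun x => ?_))
  exact ((measurePreserving_add_right volume r).comp
    (measurePreserving_sub_right volume (2 * x))).quasiMeasurePreserving

/-- The coefficients of the convolution of two basis functions at consecutive scales are, up to
normalization, values of `η_1`. -/
theorem ScalingHyp.exists_inner_conv_basisFun (hA : A.ScalingHyp) (j : ℤ) :
    ∃ c : ℝ, c ≠ 0 ∧ ∀ m p n : ℤ, inner ℝ (A.basisFun (j + 1) n)
      (conv (A.basisFun j m) (A.basisFun (j + 1) p) (hA.integrable_basisFun (j + 1) p)) =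
        c * A.eta 1 (n - 2 * m - p) := by
  set κ : ℝ := (2 : ℝ) ^ ((j : ℝ) / 2) with hκ
  set μ : ℝ := (2 : ℝ) ^ (((j + 1 : ℤ) : ℝ) / 2) with hμ
  have hκ0 : κ ≠ 0 := (Real.rpow_pos_of_pos two_pos _).ne'
  have hμ0 : μ ≠ 0 := (Real.rpow_pos_of_pos two_pos _).ne'
  set a : ℝ := (2 : ℝ) ^ j with ha
  set b : ℝ := (2 : ℝ) ^ (j + 1) with hb
  have ha0 : a ≠ 0 := zpow_ne_zero _ two_ne_zero
  have hb0 : b ≠ 0 := zpow_ne_zero _ two_ne_zero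
  have hab : b = 2 * a := by rw [hb, zpow_add_one₀ two_ne_zero, mul_comm]
  refine ⟨κ * μ * μ * |a⁻¹| * |b⁻¹|, by positivity, fun m p n => ?_⟩
  -- Substitute `s = 2^j t - m` in the convolution, then `z = 2^{j+1} x - n` in the inner product.
  have hconv : ∀ x, convAt x (A.basisFun j m) (A.basisFun (j + 1) p) =
      κ * μ * |a⁻¹| * ∫ s, A.φ s * A.φ (b * x - 2 * s - 2 * m - p) := by
    intro x
    rw [← convolution_eq_convAt, mul_assoc, ← integral_comp_mul_sub _ a m, ← integral_const_mul]
    refine integral_congr_ae ?_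
    filter_upwards [A.basisFun_coeFn j m, (Measure.measurePreserving_sub_left volume
      x).quasiMeasurePreserving.ae (A.basisFun_coeFn (j + 1) p)] with t h1 h2
    rw [ContinuousLinearMap.lsmul_apply, smul_eq_mul, h1, h2]
    have : b * x - 2 * (a * t - m) - 2 * m - p = b * (x - t) - p := by rw [hab]; ring
    rw [this]
    ring
  have hinner : inner ℝ (A.basisFun (j + 1) n)
      (conv (A.basisFun j m) (A.basisFun (j + 1) p) (hA.integrable_basisFun (j + 1) p)) =
      κ * μ * μ * |a⁻¹| * ∫ x, (fun z => A.φ z * ∫ s, A.φ s *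
        A.φ (z - 2 * s + ((n - 2 * m - p : ℤ) : ℝ))) (b * x - n) := by
    rw [L2.inner_def, ← integral_const_mul]
    refine integral_congr_ae ?_
    filter_upwards [A.basisFun_coeFn (j + 1) n, conv_coeFn (A.basisFun j m) (A.basisFun (j + 1) p)
      (hA.integrable_basisFun (j + 1) p)] with x h1 h2
    rw [h1, h2, hconv]
    have : ∀ s, b * x - n - 2 * s + ((n - 2 * m - p : ℤ) : ℝ) = b * x - 2 * s - 2 * m - p := by
      intro s; push_cast; ring
    simp only [this, RCLike.inner_apply, conj_trivial]
    ring
  rw [hinner, integral_comp_mul_sub (fun z => A.φ z * ∫ s, A.φ s *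
    A.φ (z - 2 * s + ((n - 2 * m - p : ℤ) : ℝ))), eta, Measure.volume_eq_prod, pow_one,
    integral_prod_symm _ (hA.integrable_eta _), mul_assoc _ |b⁻¹|]
  congr 2
  refine integral_congr_ae (Eventually.of_forall fun z => ?_)
  simp only
  rw [← integral_const_mul]
  congr 1
  funext s
  ring

theorem ScalingHyp.exists_eta_eq_zero (hA : A.ScalingHyp) :
    ∃ Q : ℕ, ∀ r : ℤ, (Q : ℤ) < |r| → A.eta 1 r = 0 := by
  obtain ⟨ρ, hρ, hφ⟩ := hA.exists_support_bound
  refine ⟨⌈4 * ρ⌉₊, fun r hr => ?_⟩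
  have hr' : 4 * ρ < |(r : ℝ)| := (Nat.le_ceil _).trans_lt (by exact_mod_cast hr)
  refine integral_eq_zero_of_ae (Eventually.of_forall fun p => ?_)
  by_contra hne
  have h : ∀ x, A.φ x ≠ 0 → |x| ≤ ρ := fun x hx => by
    by_contra hlt
    exact hx (hφ x (not_le.1 hlt))
  simp only [Pi.zero_apply, mul_eq_zero, not_or] at hne
  obtain ⟨⟨h1, h2⟩, h3⟩ := hne
  have h1 := abs_le.1 (h _ h1)
  have h2 := abs_le.1 (h _ h2)
  have h3 := abs_le.1 (h _ h3)
  rw [pow_one] at h3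
  rcases lt_abs.1 hr' with h4 | h4 <;> linarith [h1.1, h1.2, h2.1, h2.2, h3.1, h3.2]

/-- Uniqueness for the coefficients of a filtered signal. The lowest coefficient `a_{·,m}` enters
the outputs `n = 2m + r₀` and `n = 2m + 1 + r₀`, where `r₀` is the least index in the support of
`η`, only through the filter coefficients `d_0` and `d_1`. -/
theorem coeff_eq_zero_of_filter_eq_zero {ι κ : Type*} [Fintype ι] {η : ℤ → ℝ} {r₀ : ℤ}
    (hr₀ : η r₀ ≠ 0) (hlt : ∀ r < r₀, η r = 0) {a : ι → ℤ → ℝ} {d : ℕ → ι → κ → ℝ} {R P : ℕ}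
    (hd : ∀ v : ι → ℝ, (∀ k, ∑ i, v i * d 0 i k = 0) → (∀ k, ∑ i, v i * d 1 i k = 0) → v = 0)
    (h : ∀ k n, ∑ i, ∑ q ∈ Finset.Icc (-(R : ℤ)) R ×ˢ Finset.range (P + 2),
      a i q.1 * d q.2 i k * η (n - 2 * q.1 - q.2) = 0) :
    ∀ i, ∀ m ∈ Finset.Icc (-(R : ℤ)) R, a i m = 0 := by
  suffices H : ∀ N : ℕ, ∀ m ∈ Finset.Icc (-(R : ℤ)) R, m < -R + N → ∀ i, a i m = 0 by
    intro i m hm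
    refine H (2 * R + 1) m hm ?_ i
    rw [Finset.mem_Icc] at hm
    push_cast
    omega
  intro N
  induction N with
  | zero =>
    intro m hm hlt
    rw [Finset.mem_Icc] at hm
    simp at hlt
    omega
  | succ N ih =>
    intro m hm hmN
    rcases lt_or_ge m (-R + N) with hm' | hm'
    · exact ih m hm hm'
    -- Terms with `q.1 < m` vanish by induction. If `q.1 > m`, or `q.1 = m` and `q.2` is large,
    -- the argument of `η` is less than `r₀`.
    have hzero : ∀ (i : ι) (k : κ) (n : ℤ) (q : ℤ × ℕ),
        q ∈ Finset.Icc (-(R : ℤ)) R ×ˢ Finset.range (P + 2) → n < 2 * m + 2 + r₀ →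
        (q.1 ≠ m ∨ n < 2 * m + q.2 + r₀) →
        a i q.1 * d q.2 i k * η (n - 2 * q.1 - q.2) = 0 := by
      rintro i k n ⟨m', p⟩ hq hn hne
      rw [Finset.mem_product] at hq
      rcases lt_or_ge m' m with h1 | h1
      · rw [ih m' hq.1 (by push_cast at hmN; omega), zero_mul, zero_mul]
      · rw [hlt, mul_zero]
        dsimp only at hne ⊢
        omega
    have h0 : ∀ k, ∑ i, a i m * d 0 i k = 0 := by
      intro k
      have hk := h k (2 * m + r₀)
      have : ∀ i, ∑ q ∈ Finset.Icc (-(R : ℤ)) R ×ˢ Finset.range (P + 2),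
          a i q.1 * d q.2 i k * η (2 * m + r₀ - 2 * q.1 - q.2) = a i m * d 0 i k * η r₀ := by
        intro i
        rw [Finset.sum_eq_single_of_mem (m, 0) (Finset.mk_mem_product hm (by simp))]
        · congr 2
          push_cast
          ring
        · rintro ⟨m', p⟩ hq hne
          refine hzero i k _ _ hq (by omega) ?_
          by_contra! hc
          obtain ⟨rfl, hc⟩ := hc
          have : p = 0 := by dsimp only at hc; omega
          exact hne (by rw [this])
      simp only [this, ← Finset.sum_mul] at hk
      exact (mul_eq_zero.1 hk).resolve_right hr₀
    have h1 : ∀ k, ∑ i, a i m * d 1 i k = 0 := by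
      intro k
      have hk := h k (2 * m + 1 + r₀)
      have : ∀ i, ∑ q ∈ Finset.Icc (-(R : ℤ)) R ×ˢ Finset.range (P + 2),
          a i q.1 * d q.2 i k * η (2 * m + 1 + r₀ - 2 * q.1 - q.2) =
            a i m * d 0 i k * η (r₀ + 1) + a i m * d 1 i k * η r₀ := by
        intro i
        rw [Finset.sum_eq_add_of_mem (m, 0) (m, 1) (Finset.mk_mem_product hm (by simp))
          (Finset.mk_mem_product hm (by simp)) (by simp)]
        · congr 3 <;> push_cast <;> ring
        · rintro ⟨m', p⟩ hq ⟨hne0, hne1⟩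
          refine hzero i k _ _ hq (by omega) ?_
          by_contra! hc
          obtain ⟨rfl, hc⟩ := hc
          have : p = 0 ∨ p = 1 := by dsimp only at hc; omega
          rcases this with rfl | rfl
          · exact hne0 rfl
          · exact hne1 rfl
      simp only [this, Finset.sum_add_distrib, ← Finset.sum_mul, h0, zero_mul, zero_add] at hk
      exact (mul_eq_zero.1 hk).resolve_right hr₀
    exact fun i => congrFun (hd (fun i => a i m) h0 h1) i

end MRA

/-! ### Convolutional layers and pointwise nonlinearities on the scaling spaces -/

namespace MRA

variable {A : MRA}

theorem window_le_V (j : ℤ) (R : ℕ) : A.window j R ≤ A.V j := by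
  refine Submodule.span_le.2 ?_
  rintro _ ⟨m, -, rfl⟩
  exact A.basisFun_mem_V j m

/-- The linear part `f ↦ (P_{V_j} (∑ᵢ fᵢ * t_{i,k}))_k` of a convolutional layer. -/
def filterCLM {ι κ : Type*} [Fintype ι] {j : ℤ} (t : ι → κ → A.V j)
    (ht : ∀ i k, Integrable (t i k : L2R) volume) : (ι → L2R) →L[ℝ] (κ → A.V j) :=
  ContinuousLinearMap.pi fun k => (A.proj j).comp
    (∑ i, (convCLM (t i k) (ht i k)).comp (ContinuousLinearMap.proj i))

theorem filterCLM_apply {ι κ : Type*} [Fintype ι] {j : ℤ} (t : ι → κ → A.V j)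
    (ht : ∀ i k, Integrable (t i k : L2R) volume) (f : ι → L2R) (k : κ) :
    filterCLM t ht f k = A.proj j (∑ i, conv (f i) (t i k) (ht i k)) := by
  simp [filterCLM, convCLM_apply]

/-- The coefficients of the output of a convolutional layer, in terms of those of its input. -/
theorem ScalingHyp.exists_inner_filterCLM (hA : A.ScalingHyp) {ι κ : Type*} [Fintype ι] (j : ℤ)
    (t : ι → κ → A.V (j + 1)) (ht : ∀ i k, Integrable (t i k : L2R) volume) {P : ℕ}
    (d : ℕ → ι → κ → ℝ) (htd : ∀ i k, (t i k : L2R) =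
      ∑ p ∈ Finset.range (P + 2), d p i k • A.basisFun (j + 1) p) (R : ℕ) :
    ∃ c : ℝ, c ≠ 0 ∧ ∀ f : ι → L2R, (∀ i, f i ∈ A.window j R) → ∀ k n,
      inner ℝ (A.basisFun (j + 1) n) (filterCLM t ht f k : L2R) =
        c * ∑ i, ∑ q ∈ Finset.Icc (-(R : ℤ)) R ×ˢ Finset.range (P + 2),
          inner ℝ (A.basisFun j q.1) (f i) * d q.2 i k * A.eta 1 (n - 2 * q.1 - q.2) := by
  obtain ⟨c, hc, h⟩ := hA.exists_inner_conv_basisFun j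
  refine ⟨c, hc, fun f hf k n => ?_⟩
  rw [filterCLM_apply, inner_basisFun_proj, inner_sum, Finset.mul_sum]
  refine Finset.sum_congr rfl fun i _ => ?_
  have hfi := A.eq_sum_of_inner_eq_zero (window_le_V j R (hf i))
    (A.inner_eq_zero_of_mem_window (hf i))
  have hconv : conv (f i) (t i k) (ht i k) =
      ∑ q ∈ Finset.Icc (-(R : ℤ)) R ×ˢ Finset.range (P + 2),
        (inner ℝ (A.basisFun j q.1) (f i) * d q.2 i k) •
          conv (A.basisFun j q.1) (A.basisFun (j + 1) q.2)
            (hA.integrable_basisFun (j + 1) q.2) := by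
    have hint := ht i k
    rw [htd i k] at hint
    have := conv_sum_smul (Finset.Icc (-(R : ℤ)) R) (fun m => inner ℝ (A.basisFun j m) (f i))
      (A.basisFun j) (Finset.range (P + 2)) (fun p => d p i k)
      (fun p : ℕ => A.basisFun (j + 1) p) (fun p => hA.integrable_basisFun (j + 1) p) hint
    rw [← this]
    congr 1
    exact htd i k
  rw [hconv, inner_sum, Finset.mul_sum]
  refine Finset.sum_congr rfl fun q _ => ?_
  rw [inner_smul_right, h]
  ring

/-- A convolutional layer maps signals with finitely many coefficients to such signals. -/
theorem ScalingHyp.exists_filterCLM_mem_window (hA : A.ScalingHyp) {ι κ : Type*} [Fintype ι]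
    {j j' : ℤ} (hj : j' = j + 1)
    (t : ι → κ → A.V j') (ht : ∀ i k, Integrable (t i k : L2R) volume) {P : ℕ}
    (d : ℕ → ι → κ → ℝ) (htd : ∀ i k, (t i k : L2R) =
      ∑ p ∈ Finset.range (P + 2), d p i k • A.basisFun j' p) (R : ℕ) :
    ∃ R' : ℕ, ∀ f : ι → L2R, (∀ i, f i ∈ A.window j R) → ∀ k,
      (filterCLM t ht f k : L2R) ∈ A.window j' R' := by
  subst hj
  obtain ⟨c, -, h⟩ := hA.exists_inner_filterCLM j t ht d htd R
  obtain ⟨Q, hQ⟩ := hA.exists_eta_eq_zero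
  refine ⟨Q + 2 * R + (P + 2), fun f hf k => A.mem_window_of_inner_eq_zero (SetLike.coe_mem _)
    fun n hn => ?_⟩
  rw [h f hf, Finset.sum_eq_zero, mul_zero]
  refine fun i _ => Finset.sum_eq_zero fun q hq => ?_
  rw [hQ, mul_zero]
  rw [Finset.mem_product, Finset.mem_Icc, Finset.mem_range] at hq
  push_cast at hn
  rw [lt_abs] at hn ⊢
  omega

/-- An injective linear map on a finite-dimensional space, with values in tuples of elements of
`V_j`, is bounded below. -/
theorem exists_mul_norm_le_of_injective {A : MRA} {j : ℤ} {ι E : Type*} [Fintype ι]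
    [NormedAddCommGroup E] [NormedSpace ℝ E] [FiniteDimensional ℝ E] (T : E →ₗ[ℝ] (ι → A.V j))
    (hT : Function.Injective T) : ∃ c : ℝ, 0 < c ∧ ∀ v, c * ‖v‖ ≤ ‖T v‖ := by
  obtain ⟨k, hk, hanti⟩ := @LinearMap.exists_antilipschitzWith ℝ _ E _ _ (ι → A.V j) _ _ _ _ T
    (LinearMap.ker_eq_bot.2 hT)
  have hk' : (0 : ℝ) < k := hk
  refine ⟨(k : ℝ)⁻¹, by positivity, fun v => ?_⟩
  rw [inv_mul_le_iff₀ hk']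
  have h := hanti.le_mul_dist v 0
  rwa [map_zero, dist_zero_right, dist_zero_right] at h

/-- A convolutional layer is bounded below on signals with coefficients in a given window. -/
theorem ScalingHyp.exists_le_norm_filterCLM (hA : A.ScalingHyp) {ι κ : Type*} [Fintype ι]
    [Fintype κ] {j j' : ℤ} (hj : j' = j + 1)
    (t : ι → κ → A.V j') (ht : ∀ i k, Integrable (t i k : L2R) volume) {P : ℕ}
    (d : ℕ → ι → κ → ℝ) (htd : ∀ i k, (t i k : L2R) =
      ∑ p ∈ Finset.range (P + 2), d p i k • A.basisFun j' p)
    (hd : ∀ v : ι → ℝ, (∀ k, ∑ i, v i * d 0 i k = 0) → (∀ k, ∑ i, v i * d 1 i k = 0) → v = 0)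
    (R : ℕ) :
    ∃ c : ℝ, 0 < c ∧ ∀ f : ι → L2R, (∀ i, f i ∈ A.window j R) → c * ‖f‖ ≤ ‖filterCLM t ht f‖ := by
  subst hj
  obtain ⟨c, hc, h⟩ := hA.exists_inner_filterCLM j t ht d htd R
  obtain ⟨Q, hQ⟩ := hA.exists_eta_eq_zero
  obtain ⟨r₀, hr₀, hmin⟩ := Int.exists_least_of_bdd (P := fun r => A.eta 1 r ≠ 0)
    ⟨-Q, fun r hr => by
      by_contra hlt
      exact hr (hQ r (by rw [lt_abs]; omega))⟩ hA.eta_ne_zero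
  let ext : (ι → A.window j R) →ₗ[ℝ] (ι → L2R) :=
    LinearMap.pi fun i => (A.window j R).subtype ∘ₗ LinearMap.proj i
  let T : (ι → A.window j R) →ₗ[ℝ] (κ → A.V (j + 1)) := (filterCLM t ht).toLinearMap ∘ₗ ext
  have hT : Function.Injective T := by
    rw [injective_iff_map_eq_zero]
    intro f hf
    have hcoef := coeff_eq_zero_of_filter_eq_zero (P := P) (R := R)
      (a := fun i m => inner ℝ (A.basisFun j m) (f i : L2R)) hr₀
      (fun r hr => by_contra fun hne => absurd (hmin r hne) (not_le.2 hr)) hd fun k n => by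
        have h1 := h (fun i => (f i : L2R)) (fun i => (f i).2) k n
        have h2 : filterCLM t ht (fun i => (f i : L2R)) = 0 := hf
        rw [h2] at h1
        simp only [Pi.zero_apply, ZeroMemClass.coe_zero, inner_zero_right] at h1
        exact (mul_eq_zero.1 h1.symm).resolve_left hc
    funext i
    refine Subtype.ext ?_
    rw [A.eq_sum_of_inner_eq_zero (window_le_V j R (f i).2)
      (A.inner_eq_zero_of_mem_window (f i).2)]
    refine Finset.sum_eq_zero fun m hm => ?_
    rw [hcoef i m hm, zero_smul]
  obtain ⟨k, hk, hlow⟩ := @exists_mul_norm_le_of_injective A (j + 1) κ (ι → A.window j R)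
    _ _ _ _ T hT
  exact ⟨k, hk, fun f hf => hlow fun i => ⟨f i, hf i⟩⟩

end MRA

theorem memLp_bounded_mul {w : ℝ → ℝ} (hw : AEStronglyMeasurable w volume) {M : ℝ}
    (hM : ∀ x, |w x| ≤ M) (f : L2R) : MemLp (fun x => w x * f x) 2 volume :=
  (Lp.memLp f).of_le_mul (c := M) (hw.mul (Lp.memLp f).1) (Eventually.of_forall fun x => by
    rw [norm_mul]
    exact mul_le_mul_of_nonneg_right (hM x) (norm_nonneg _))

/-- Multiplication by a bounded measurable function, as an operator on `L²(ℝ)`. -/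
def mulCLM (w : ℝ → ℝ) (hw : AEStronglyMeasurable w volume) (M : ℝ) (hM : ∀ x, |w x| ≤ M) :
    L2R →L[ℝ] L2R :=
  LinearMap.mkContinuous
    { toFun := fun f => (memLp_bounded_mul hw hM f).toLp _
      map_add' := fun f g => by
        rw [← MemLp.toLp_add]
        refine MemLp.toLp_congr _ _ ?_
        filter_upwards [Lp.coeFn_add f g] with x hx
        rw [hx, Pi.add_apply, Pi.add_apply, mul_add]
      map_smul' := fun c f => by
        rw [RingHom.id_apply, ← MemLp.toLp_const_smul]
        refine MemLp.toLp_congr _ _ ?_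
        filter_upwards [Lp.coeFn_smul c f] with x hx
        rw [hx, Pi.smul_apply, Pi.smul_apply, smul_eq_mul, smul_eq_mul, mul_left_comm] }
    M fun f => by
      refine Lp.norm_le_mul_norm_of_ae_le_mul ?_
      filter_upwards [MemLp.coeFn_toLp (memLp_bounded_mul hw hM f)] with x hx
      refine (congrArg norm hx).trans_le ?_
      rw [norm_mul]
      exact mul_le_mul_of_nonneg_right (hM x) (norm_nonneg _)

theorem mulCLM_coeFn (w : ℝ → ℝ) (hw : AEStronglyMeasurable w volume) (M : ℝ)
    (hM : ∀ x, |w x| ≤ M) (f : L2R) : ⇑(mulCLM w hw M hM f) =ᵐ[volume] fun x => w x * f x :=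
  MemLp.coeFn_toLp (memLp_bounded_mul hw hM f)

theorem nonlin_coeFn (s : ℝ → ℝ) (hs : Measurable s) (hg : ∃ C : ℝ, ∀ x, |s x| ≤ C * |x|)
    (f : L2R) : ⇑(nonlin s hs hg f) =ᵐ[volume] fun x => s (f x) :=
  MemLp.coeFn_toLp (memLp_comp_of_growth hs hg (Lp.memLp f))

/-- A `C¹` function is strictly differentiable uniformly on bounded sets. -/
theorem exists_abs_sub_sub_deriv_le {s : ℝ → ℝ} (hs : ContDiff ℝ 1 s) (B : ℝ) {ε : ℝ}
    (hε : 0 < ε) : ∃ δ > 0, ∀ y u v, |y| ≤ B → |u - y| ≤ δ → |v - y| ≤ δ →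
      |s u - s v - deriv s y * (u - v)| ≤ ε * |u - v| := by
  have huc := (isCompact_Icc (a := -(B + 1)) (b := B + 1)).uniformContinuousOn_of_continuous
    (hs.continuous_deriv le_rfl).continuousOn
  obtain ⟨δ, hδ, h⟩ := Metric.uniformContinuousOn_iff.1 huc ε hε
  refine ⟨min (δ / 2) 1, by positivity, fun y u v hy hu hv => ?_⟩
  have hder : ∀ x, HasDerivAt (fun x => s x - deriv s y * x) (deriv s x - deriv s y) x := by
    intro x
    have := ((hs.differentiable one_ne_zero).differentiableAt.hasDerivAt (x := x)).fun_sub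
      ((hasDerivAt_id' x).const_mul (deriv s y))
    rwa [mul_one] at this
  have hbound : ∀ x ∈ Metric.closedBall y (min (δ / 2) 1), ‖deriv s x - deriv s y‖ ≤ ε := by
    intro x hx
    rw [Metric.mem_closedBall, le_min_iff, Real.dist_eq] at hx
    have h1 := abs_le.1 hy
    have h2 := abs_le.1 hx.2
    rw [← dist_eq_norm]
    refine (h x ⟨by linarith, by linarith⟩ y ⟨by linarith, by linarith⟩ ?_).le
    rw [Real.dist_eq]
    linarith
  have := (convex_closedBall y (min (δ / 2) 1)).norm_image_sub_le_of_norm_hasDerivWithin_le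
    (fun x _ => (hder x).hasDerivWithinAt) hbound (x := v) (y := u)
    (by rwa [Metric.mem_closedBall, Real.dist_eq]) (by rwa [Metric.mem_closedBall, Real.dist_eq])
  rw [Real.norm_eq_abs, Real.norm_eq_abs] at this
  convert this using 2
  ring

/-- The map `f ↦ s ∘ f` is in general not Fréchet differentiable on `L²(ℝ)`, but it is strictly
differentiable on a subspace on which the `L²` norm controls the supremum norm. -/
theorem exists_hasStrictFDerivAt_nonlin {s : ℝ → ℝ} (hs : Measurable s)
    (hg : ∃ C : ℝ, ∀ x, |s x| ≤ C * |x|) (hC1 : ContDiff ℝ 1 s) {M : ℝ}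
    (hM : ∀ x, |deriv s x| ≤ M) {V : Submodule ℝ L2R} {C : ℝ} (hC : 0 < C)
    (hV : ∀ f ∈ V, ∀ᵐ x : ℝ, |f x| ≤ C * ‖f‖) (f₀ : V) :
    ∃ D : V →L[ℝ] L2R, HasStrictFDerivAt (fun f : V => nonlin s hs hg f) D f₀ := by
  have hw : AEStronglyMeasurable (fun x => deriv s ((f₀ : L2R) x)) volume :=
    (hC1.continuous_deriv le_rfl).comp_aestronglyMeasurable (Lp.memLp (f₀ : L2R)).1
  -- The derivative is multiplication by `s' ∘ f₀`.
  refine ⟨(mulCLM _ hw M fun x => hM _).comp V.subtypeL, .of_isLittleO ?_⟩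
  refine Asymptotics.isLittleO_iff.2 fun ε hε => ?_
  obtain ⟨δ, hδ, h⟩ := exists_abs_sub_sub_deriv_le hC1 (C * ‖f₀‖) hε
  have hball := Metric.closedBall_mem_nhds f₀ (show 0 < δ / C by positivity)
  filter_upwards [prod_mem_nhds hball hball] with p hp
  have hclose : ∀ f : V, f ∈ Metric.closedBall f₀ (δ / C) →
      ∀ᵐ x : ℝ, |(f : L2R) x - (f₀ : L2R) x| ≤ δ := by
    intro f hf
    rw [Metric.mem_closedBall, dist_eq_norm, le_div_iff₀ hC, mul_comm] at hf
    filter_upwards [hV _ (f - f₀).2, Lp.coeFn_sub (f : L2R) (f₀ : L2R)] with x h1 h2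
    rw [Submodule.coe_sub, h2, Pi.sub_apply] at h1
    exact h1.trans hf
  change _ ≤ ε * ‖(p.1 : L2R) - p.2‖
  refine Lp.norm_le_mul_norm_of_ae_le_mul ?_
  filter_upwards [hclose _ hp.1, hclose _ hp.2, hV _ f₀.2, nonlin_coeFn s hs hg (p.1 : L2R),
    nonlin_coeFn s hs hg (p.2 : L2R), mulCLM_coeFn _ hw M (fun x => hM _) (p.1 - p.2 : L2R),
    Lp.coeFn_sub (p.1 : L2R) (p.2 : L2R),
    Lp.coeFn_sub (nonlin s hs hg (p.1 : L2R)) (nonlin s hs hg (p.2 : L2R)),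
    Lp.coeFn_sub (nonlin s hs hg (p.1 : L2R) - nonlin s hs hg (p.2 : L2R))
      (mulCLM _ hw M (fun x => hM _) (p.1 - p.2 : L2R))] with x h1 h2 h3 h4 h5 h6 h7 h8 h9
  have := h _ _ _ h3 h1 h2
  rw [h7, Pi.sub_apply]
  refine (congrArg norm h9).trans_le ?_
  rw [Pi.sub_apply, h8, Pi.sub_apply, h4, h5, h6, h7, Pi.sub_apply]
  exact this

theorem mul_norm_sq_le_inner_nonlin_sub {s : ℝ → ℝ} (hs : Measurable s)
    (hg : ∃ C : ℝ, ∀ x, |s x| ≤ C * |x|) (hd : Differentiable ℝ s) {M : ℝ}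
    (hM : ∀ x, M ≤ deriv s x) (f h : L2R) :
    M * ‖f - h‖ ^ 2 ≤ inner ℝ (nonlin s hs hg f - nonlin s hs hg h) (f - h) := by
  have hmono : ∀ u v, M * inner ℝ (u - v) (u - v) ≤ inner ℝ (s u - s v) (u - v) := by
    intro u v
    simp only [RCLike.inner_apply, conj_trivial]
    rcases le_total v u with huv | huv
    · have := mul_sub_le_image_sub_of_le_deriv hd hM huv
      nlinarith
    · have := mul_sub_le_image_sub_of_le_deriv hd hM huv
      nlinarith
  rw [← real_inner_self_eq_norm_sq, L2.inner_def, L2.inner_def, ← integral_const_mul]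
  refine integral_mono_ae ((L2.integrable_inner (f - h) (f - h)).const_mul M)
    (L2.integrable_inner _ _) ?_
  filter_upwards [Lp.coeFn_sub f h, Lp.coeFn_sub (nonlin s hs hg f) (nonlin s hs hg h),
    nonlin_coeFn s hs hg f, nonlin_coeFn s hs hg h] with x h1 h2 h3 h4
  rw [h1, h2, Pi.sub_apply, Pi.sub_apply, h3, h4]
  exact hmono (f x) (h x)

namespace MRA

variable {A : MRA}

/-- The projected nonlinearity is strongly monotone on `V_j`, hence expands distances by at least
the lower bound of the derivative. -/
theorem mul_norm_sub_le_norm_proj_nonlin_sub {s : ℝ → ℝ} (hs : Measurable s)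
    (hg : ∃ C : ℝ, ∀ x, |s x| ≤ C * |x|) (hd : Differentiable ℝ s) {M : ℝ}
    (hM : ∀ x, M ≤ deriv s x) {j : ℤ} (f h : A.V j) :
    M * ‖f - h‖ ≤ ‖A.proj j (nonlin s hs hg f) - A.proj j (nonlin s hs hg h)‖ := by
  rcases eq_or_ne f h with rfl | hne
  · simp
  have hpos : 0 < ‖f - h‖ := norm_pos_iff.2 (sub_ne_zero.2 hne)
  refine le_of_mul_le_mul_right ?_ hpos
  calc M * ‖f - h‖ * ‖f - h‖ = M * ‖(f : L2R) - h‖ ^ 2 := by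
        rw [mul_assoc, ← sq]; rfl
    _ ≤ inner ℝ (nonlin s hs hg f - nonlin s hs hg h) ((f : L2R) - h) :=
        mul_norm_sq_le_inner_nonlin_sub hs hg hd hM _ _
    _ = inner ℝ (A.proj j (nonlin s hs hg f - nonlin s hs hg h)) (f - h) :=
        (Submodule.inner_orthogonalProjectionOnto_eq_of_mem_right (f - h) _).symm
    _ ≤ _ := by
        rw [map_sub]
        exact real_inner_le_norm _ _

theorem ScalingHyp.exists_proj_nonlin_sub_mem_window (hA : A.ScalingHyp) {s : ℝ → ℝ}
    (hs : Measurable s) (hg : ∃ C : ℝ, ∀ x, |s x| ≤ C * |x|) (j : ℤ) (R : ℕ) :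
    ∃ R' : ℕ, ∀ f h : L2R, f - h ∈ A.window j R →
      (A.proj j (nonlin s hs hg f) - A.proj j (nonlin s hs hg h) : L2R) ∈ A.window j R' := by
  obtain ⟨a, ha⟩ := hA.exists_window_support j R
  obtain ⟨R', hR'⟩ := hA.exists_inner_eq_zero j a
  refine ⟨R', fun f h hfh => ?_⟩
  refine A.mem_window_of_inner_eq_zero (Submodule.sub_mem _ (SetLike.coe_mem _)
    (SetLike.coe_mem _)) fun m hm => ?_
  rw [inner_sub_right, inner_basisFun_proj, inner_basisFun_proj, ← inner_sub_right]
  refine hR' _ ?_ m hm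
  filter_upwards [ha _ hfh, Lp.coeFn_sub f h,
    Lp.coeFn_sub (nonlin s hs hg f) (nonlin s hs hg h),
    nonlin_coeFn s hs hg f, nonlin_coeFn s hs hg h] with x h1 h2 h3 h4 h5 hx
  have h6 := h1 hx
  rw [h2, Pi.sub_apply, sub_eq_zero] at h6
  rw [h3, Pi.sub_apply, h4, h5, h6, sub_self]

end MRA

/-! ### Induction over the layers -/

/-- Strict Fréchet differentiability over `ℝ`, without reference to the derivative. -/
def StrictDiffAt {E F : Type*} [NormedAddCommGroup E] [NormedSpace ℝ E] [NormedAddCommGroup F]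
    [NormedSpace ℝ F] (f : E → F) (z : E) : Prop :=
  ∃ D : E →L[ℝ] F, HasStrictFDerivAt f D z

namespace StrictDiffAt

variable {E F G : Type*} [NormedAddCommGroup E] [NormedSpace ℝ E] [NormedAddCommGroup F]
  [NormedSpace ℝ F] [NormedAddCommGroup G] [NormedSpace ℝ G]

theorem comp {g : F → G} {f : E → F} {z : E} (hg : StrictDiffAt g (f z)) (hf : StrictDiffAt f z) :
    StrictDiffAt (fun x => g (f x)) z := by
  obtain ⟨D, hD⟩ := hg
  obtain ⟨D', hD'⟩ := hf
  exact ⟨_, hD.comp z hD'⟩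

theorem clm (T : E →L[ℝ] F) (z : E) : StrictDiffAt T z :=
  ⟨T, T.hasStrictFDerivAt⟩

theorem add_const {f : E → F} {z : E} (hf : StrictDiffAt f z) (b : F) :
    StrictDiffAt (fun x => f x + b) z := by
  obtain ⟨D, hD⟩ := hf
  exact ⟨D, hD.add_const b⟩

theorem pi {ι : Type*} [Fintype ι] {f : E → ι → F} {z : E}
    (hf : ∀ i, StrictDiffAt (fun x => f x i) z) : StrictDiffAt f z := by
  choose D hD using hf
  exact ⟨ContinuousLinearMap.pi D, hasStrictFDerivAt_pi.2 hD⟩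

theorem apply {ι : Type*} [Fintype ι] {f : E → ι → F} {z : E} (hf : StrictDiffAt f z) (i : ι) :
    StrictDiffAt (fun x => f x i) z := by
  obtain ⟨D, hD⟩ := hf
  exact ⟨_, hasStrictFDerivAt_pi'.1 hD i⟩

end StrictDiffAt

namespace CGNN

variable {S n : ℕ} {N : CGNN S n}

/-- The columns of the filter matrix are those of `d_0` followed by those of `d_1`, so a vector
annihilated by both blocks is annihilated by a nonsingular matrix. -/
theorem vecMul_filterMatrix_eq_zero {l : Fin n}
    {d : ℕ → Fin (channels n l.castSucc) → Fin (channels n l.succ) → ℝ}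
    (hd : (filterMatrix l d).det ≠ 0) (v : Fin (channels n l.castSucc) → ℝ)
    (h0 : ∀ k, ∑ i, v i * d 0 i k = 0) (h1 : ∀ k, ∑ i, v i * d 1 i k = 0) : v = 0 := by
  refine Matrix.eq_zero_of_vecMul_eq_zero hd ?_
  funext k
  simp only [Matrix.vecMul, dotProduct, filterMatrix, Matrix.of_apply, Pi.zero_apply]
  generalize Fin.cast (channels_castSucc l) k = k'
  induction k' using Fin.addCases with
  | left k => simpa using h0 k
  | right k => simpa only [Fin.append_right] using h1 k

theorem strictDiffAt_activation (hV : N.A.ScalingHyp) (hσ : N.NonlinearityHyp)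
    (l : Fin (n + 1)) (f : N.LayerSpace l) : StrictDiffAt (N.activation l) f := by
  obtain ⟨M₁, M₂, h1, h2, hM⟩ := hσ.deriv_bounds
  obtain ⟨C, hC, hsup⟩ := hV.exists_ae_abs_le (scale N.j₁ l)
  refine StrictDiffAt.pi fun k => ?_
  have hk : StrictDiffAt (fun f : N.LayerSpace l => f k) f :=
    StrictDiffAt.clm (ContinuousLinearMap.proj (R := ℝ) k) f
  refine (StrictDiffAt.clm (N.A.proj (scale N.j₁ l)) _).comp (StrictDiffAt.comp
    (g := fun f : N.A.V (scale N.j₁ l) => nonlin N.σ N.measurable_σ N.growth_σ f) ?_ hk)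
  exact exists_hasStrictFDerivAt_nonlin N.measurable_σ N.growth_σ hσ.contDiff
    (M := M₂) (fun x => abs_le.2 ⟨by linarith [(hM x).1], (hM x).2⟩) hC hsup (f k)

theorem exists_mul_norm_le_activation (hσ : N.NonlinearityHyp) (l : Fin (n + 1)) :
    ∃ c : ℝ, 0 < c ∧ ∀ f h : N.LayerSpace l,
      c * ‖f - h‖ ≤ ‖N.activation l f - N.activation l h‖ := by
  obtain ⟨M₁, M₂, h1, h2, hM⟩ := hσ.deriv_bounds
  refine ⟨M₁, h1, fun f h => ?_⟩
  rw [← le_inv_mul_iff₀ h1, pi_norm_le_iff_of_nonneg (by positivity)]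
  intro k
  rw [le_inv_mul_iff₀ h1]
  exact (MRA.mul_norm_sub_le_norm_proj_nonlin_sub N.measurable_σ N.growth_σ
    (hσ.contDiff.differentiable one_ne_zero) (fun x => (hM x).1) (f k) (h k)).trans
    (norm_le_pi_norm (N.activation l f - N.activation l h) k)

/-- The inclusion of a layer space into the space of tuples in `L²(ℝ)`. -/
def inclusion (N : CGNN S n) (l : Fin (n + 1)) :
    N.LayerSpace l →L[ℝ] (Fin (channels n l) → L2R) :=
  ContinuousLinearMap.pi fun i =>
    (N.A.V (scale N.j₁ l)).subtypeL.comp (ContinuousLinearMap.proj i)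

theorem norm_inclusion (l : Fin (n + 1)) (f : N.LayerSpace l) : ‖N.inclusion l f‖ = ‖f‖ := rfl

theorem convLayer_eq (l : Fin n) (f : N.LayerSpace l.castSucc) :
    N.convLayer l f = MRA.filterCLM (N.t l) (N.integrable_t l) (N.inclusion l.castSucc f) +
      fun k => N.A.proj (scale N.j₁ l.succ) (N.β l k) := by
  funext k
  rw [Pi.add_apply, MRA.filterCLM_apply, ← map_add]
  rfl

theorem convLayer_sub (l : Fin n) (f h : N.LayerSpace l.castSucc) :
    N.convLayer l f - N.convLayer l h =
      MRA.filterCLM (N.t l) (N.integrable_t l) (N.inclusion l.castSucc (f - h)) := by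
  rw [convLayer_eq, convLayer_eq, add_sub_add_right_eq_sub, ← map_sub, ← map_sub]

theorem layerOutput_succ (l : Fin n) (z : EuclideanSpace ℝ (Fin S)) :
    N.layerOutput l.succ z =
      N.activation l.succ (N.convLayer l (N.layerOutput l.castSucc z)) := rfl

theorem scale_succ (j₁ : ℤ) (l : Fin n) : scale j₁ l.succ = scale j₁ l.castSucc + 1 := by
  simp [scale, add_assoc]

/-- On inputs differing by an element of a given window, a convolutional layer has outputs
differing by an element of another window, at a distance at least a positive multiple of that of
the inputs. -/
theorem FilterHyp.exists_convLayer_sub_mem_window (ht : N.FilterHyp) (hV : N.A.ScalingHyp)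
    (l : Fin n) (R : ℕ) :
    (∃ R' : ℕ, ∀ f h : N.LayerSpace l.castSucc,
      (∀ i, (f i - h i : L2R) ∈ N.A.window (scale N.j₁ l.castSucc) R) →
        ∀ k, (N.convLayer l f k - N.convLayer l h k : L2R) ∈
          N.A.window (scale N.j₁ l.succ) R') ∧
    ∃ c : ℝ, 0 < c ∧ ∀ f h : N.LayerSpace l.castSucc,
      (∀ i, (f i - h i : L2R) ∈ N.A.window (scale N.j₁ l.castSucc) R) →
        c * ‖f - h‖ ≤ ‖N.convLayer l f - N.convLayer l h‖ := by
  obtain ⟨pbar, d, hd0, htd, hdet⟩ := ht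
  -- One more filter coefficient is included, so that `d 1` occurs in the sum also if `pbar = 0`.
  have htd' : ∀ i k, (N.t l i k : L2R) = ∑ p ∈ Finset.range (pbar + 2),
      d l p i k • N.A.basisFun (scale N.j₁ l.succ) p := fun i k => by
    rw [htd, Finset.sum_range_succ _ (pbar + 1), hd0 l (pbar + 1) i k (Nat.lt_succ_self _),
      zero_smul, add_zero]
  constructor
  · obtain ⟨R', h⟩ := hV.exists_filterCLM_mem_window (scale_succ N.j₁ l) (N.t l)
      (N.integrable_t l) (d l) htd' R
    refine ⟨R', fun f g hfg k => ?_⟩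
    have h1 := congrArg Subtype.val (congrFun (convLayer_sub l f g) k)
    rw [Pi.sub_apply, Submodule.coe_sub] at h1
    rw [h1]
    exact h _ hfg k
  · obtain ⟨c, hc, h⟩ := hV.exists_le_norm_filterCLM (scale_succ N.j₁ l) (N.t l)
      (N.integrable_t l) (d l) htd' (vecMul_filterMatrix_eq_zero (hdet l)) R
    refine ⟨c, hc, fun f g hfg => ?_⟩
    rw [convLayer_sub, ← norm_inclusion]
    exact h _ hfg

theorem strictDiffAt_layerOutput (hV : N.A.ScalingHyp) (hσ : N.NonlinearityHyp)
    (l : Fin (n + 1)) (z : EuclideanSpace ℝ (Fin S)) : StrictDiffAt (N.layerOutput l) z := by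
  induction l using Fin.induction with
  | zero =>
    have hfc : StrictDiffAt N.fullyConnected z :=
      (StrictDiffAt.clm N.F.toContinuousLinearMap z).add_const N.b
    exact (strictDiffAt_activation hV hσ 0 _).comp hfc
  | succ l ih =>
    have hconv : StrictDiffAt (N.convLayer l) (N.layerOutput l.castSucc z) := by
      rw [funext (convLayer_eq (N := N) l)]
      exact (@StrictDiffAt.clm (N.LayerSpace l.castSucc) (N.LayerSpace l.succ) _ _ _ _
        ((MRA.filterCLM (N.t l) (N.integrable_t l)).comp (N.inclusion l.castSucc)) _).add_const _
    exact (strictDiffAt_activation hV hσ l.succ _).comp (hconv.comp ih)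

/-- The outputs of each layer differ by signals with coefficients in a fixed window, and their
distance is at least a positive multiple of the distance of the latent variables. As the
biases need not have finitely many coefficients, only differences of outputs do. -/
theorem exists_mul_norm_le_layerOutput (hV : N.A.ScalingHyp) (ht : N.FilterHyp)
    (hσ : N.NonlinearityHyp) (hF : N.FullyConnectedHyp) (l : Fin (n + 1)) :
    (∃ R : ℕ, ∀ z w k, (N.layerOutput l z k - N.layerOutput l w k : L2R) ∈
      N.A.window (scale N.j₁ l) R) ∧
    ∃ c : ℝ, 0 < c ∧ ∀ z w, c * ‖z - w‖ ≤ ‖N.layerOutput l z - N.layerOutput l w‖ := by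
  induction l using Fin.induction with
  | zero =>
    have hsub : ∀ z w, N.fullyConnected z - N.fullyConnected w = N.F (z - w) := fun z w => by
      rw [fullyConnected, fullyConnected, add_sub_add_right_eq_sub, map_sub]
    constructor
    · obtain ⟨R, -, hR⟩ := hF.finite_span
      obtain ⟨R', hR'⟩ := hV.exists_proj_nonlin_sub_mem_window N.measurable_σ N.growth_σ
        (scale N.j₁ (0 : Fin (n + 1))) R
      refine ⟨R', fun z w k => hR' _ _ ?_⟩
      have := congrArg Subtype.val (congrFun (hsub z w) k)
      rw [Pi.sub_apply, Submodule.coe_sub] at this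
      rw [this]
      exact hR _ _
    · obtain ⟨c, hc, hact⟩ := exists_mul_norm_le_activation hσ (0 : Fin (n + 1))
      obtain ⟨k, hk, hlow⟩ : ∃ k : ℝ, 0 < k ∧ ∀ v, k * ‖v‖ ≤ ‖N.F v‖ :=
        MRA.exists_mul_norm_le_of_injective N.F hF.injective
      refine ⟨c * k, by positivity, fun z w => ?_⟩
      refine le_trans ?_ (hact (N.fullyConnected z) (N.fullyConnected w))
      rw [mul_assoc, hsub]
      exact mul_le_mul_of_nonneg_left (hlow _) hc.le
  | succ l ih =>
    obtain ⟨⟨R, hR⟩, c, hc, hlow⟩ := ih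
    obtain ⟨⟨R', hR'⟩, c', hc', hlow'⟩ := ht.exists_convLayer_sub_mem_window hV l R
    constructor
    · obtain ⟨R'', hR''⟩ := hV.exists_proj_nonlin_sub_mem_window N.measurable_σ N.growth_σ
        (scale N.j₁ l.succ) R'
      exact ⟨R'', fun z w k => hR'' _ _ (hR' _ _ (hR z w) k)⟩
    · obtain ⟨c'', hc'', hact⟩ := exists_mul_norm_le_activation hσ l.succ
      refine ⟨c'' * (c' * c), by positivity, fun z w => ?_⟩
      rw [layerOutput_succ, layerOutput_succ]
      refine le_trans ?_ (hact _ _)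
      rw [mul_assoc]
      refine mul_le_mul_of_nonneg_left (le_trans ?_ (hlow' _ _ (hR z w))) hc''.le
      rw [mul_assoc]
      exact mul_le_mul_of_nonneg_left (hlow z w) hc'.le

theorem strictDiffAt_generator (hV : N.A.ScalingHyp) (hσ : N.NonlinearityHyp)
    (z : EuclideanSpace ℝ (Fin S)) : StrictDiffAt N.generator z := by
  exact (StrictDiffAt.clm (N.A.V _).subtypeL _).comp
    ((strictDiffAt_layerOutput hV hσ (Fin.last n) z).apply ⟨0, channels_last_pos n⟩)

theorem exists_mul_norm_le_generator (hV : N.A.ScalingHyp) (ht : N.FilterHyp)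
    (hσ : N.NonlinearityHyp) (hF : N.FullyConnectedHyp) :
    ∃ c : ℝ, 0 < c ∧ ∀ z w, c * ‖z - w‖ ≤ ‖N.generator z - N.generator w‖ := by
  obtain ⟨-, c, hc, h⟩ := exists_mul_norm_le_layerOutput hV ht hσ hF (Fin.last n)
  refine ⟨c, hc, fun z w => (h z w).trans ?_⟩
  rw [pi_norm_le_iff_of_nonneg (norm_nonneg _)]
  intro k
  have hk : k = ⟨0, channels_last_pos n⟩ := by
    have h1 := k.2
    have h2 : channels n (Fin.last n) = 1 := by simp [channels]
    exact Fin.ext (by dsimp only; omega)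
  rw [hk]
  rfl

end CGNN

/-- If `‖G z - G w‖` is at least a positive multiple of `‖z - w‖`, then so is the norm of every
difference quotient, and hence `‖G' v‖` of `‖v‖`. -/
theorem injective_fderiv_of_mul_norm_le {E H : Type*} [NormedAddCommGroup E] [NormedSpace ℝ E]
    [NormedAddCommGroup H] [NormedSpace ℝ H] {G : E → H} {c : ℝ} (hc : 0 < c)
    (hlow : ∀ z w, c * ‖z - w‖ ≤ ‖G z - G w‖) {G' : E →L[ℝ] H} {z : E}
    (hG : HasFDerivAt G G' z) : Function.Injective G' := by
  rw [injective_iff_map_eq_zero]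
  intro v hv
  have hlim := (hG.comp_hasDerivAt_of_eq (0 : ℝ)
    (((hasDerivAt_id (0 : ℝ)).smul_const v).const_add z) (by simp)).tendsto_slope.norm
  have hge : c * ‖v‖ ≤ ‖G' ((1 : ℝ) • v)‖ := by
    refine ge_of_tendsto hlim ?_
    filter_upwards [self_mem_nhdsWithin] with s hs
    have hs0 : 0 < |s| := abs_pos.2 hs
    have := hlow (z + s • v) z
    rw [add_sub_cancel_left, norm_smul, Real.norm_eq_abs] at this
    simp only [slope, vsub_eq_sub, sub_zero, Function.comp_apply, id_eq, zero_smul, add_zero,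
      norm_smul, norm_inv, Real.norm_eq_abs]
    rw [le_inv_mul_iff₀ hs0]
    linarith
  rw [one_smul, hv, norm_zero] at hge
  exact norm_le_zero_iff.1 (nonpos_of_mul_nonpos_right hge hc)

end ContGen
end

theorem theorem2 {S n : ℕ} (N : ContGen.CGNN S n)
    (hV : N.A.ScalingHyp) (ht : N.FilterHyp) (hσ : N.NonlinearityHyp)
    (hF : N.FullyConnectedHyp)
    (K : Set ContGen.L2R) (hK : IsCompact K) (hKM : K ⊆ N.manifold)
    {Y : Type*} [NormedAddCommGroup Y] [NormedSpace ℝ Y] [CompleteSpace Y]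
    (Φ : ContGen.L2R → Y) (hΦ : ContDiff ℝ 1 Φ) (hΦinj : Function.Injective Φ)
    (hΦtan : ∀ x ∈ N.manifold, Set.InjOn (fderiv ℝ Φ x) (N.tangentSpace x)) :
    ∃ C : ℝ, 0 < C ∧ ∀ x ∈ K, ∀ y ∈ K, ‖x - y‖ ≤ C * ‖Φ x - Φ y‖ := by
  obtain ⟨c, hc, hlow⟩ := ContGen.CGNN.exists_mul_norm_le_generator hV ht hσ hF
  have hG : ∀ z, HasStrictFDerivAt N.generator (fderiv ℝ N.generator z) z := fun z => by
    obtain ⟨D, hD⟩ := ContGen.CGNN.strictDiffAt_generator hV hσ z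
    rwa [hD.hasFDerivAt.fderiv]
  refine ContGen.exists_norm_sub_le_on_compact hc hlow hG hΦ hΦinj (fun z => ?_) hK hKM
  have hmem : ∀ v, fderiv ℝ N.generator z v ∈ N.tangentSpace (N.generator z) := fun v =>
    Submodule.mem_iSup_of_mem z (Submodule.mem_iSup_of_mem rfl ⟨v, rfl⟩)
  intro v w hvw
  exact ContGen.injective_fderiv_of_mul_norm_le hc hlow (hG z).hasFDerivAt
    (hΦtan _ ⟨z, rfl⟩ (hmem v) (hmem w) hvw)
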